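/- Let $n\ge 2$, $\lambda>0$ and $R_0>0$, and put $\Omega=\{x\in\mathbb R^n : |x|>R_0\}$. (i) Let $f:\Omega\to\mathbb C$ be a classical ($C^2$) solution of the Helmholtz equation $\Delta f=-\lambda f$ in $\Omega$. If for some $0<p\le \frac{2n}{n-1}$ $$\int_{|x|>R_0+4}|f|^p\,dx<\infty ,$$ then $f\equiv 0$ in $\Omega$. (ii) The exponent $\frac{2n}{n-1}$ is sharp: for every real $p>\frac{2n}{n-1}$ there are solutions of $\Delta f=-\lambda f$ in $\Omega$ that do not vanish identically in $\Omega$ and satisfy $\int_\Omega|f|^p\,dx<\infty$. An example is $$f(x)=|x|^{-\frac{n-2}{2}}J_{\frac{n-2}{2}}\bigl(\sqrt{\lambda}\,|x|\bigr),\qquad J_\nu(r)=\sum_{k=0}^\infty\frac{(-1)^k}{k!\,\Gamma(k+\nu+1)}\Bigl(\frac r2\Bigr)^{2k+\nu},$$ where $J_\nu$ is the Bessel function of the first kind. -/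

import Mathlib

open MeasureTheory
open scoped ENNReal Topology

noncomputable section

/-- The exterior domain `{x ∈ ℝⁿ : |x| > R}`, with the Euclidean norm. -/
def exteriorDomain (n : ℕ) (R : ℝ) : Set (EuclideanSpace ℝ (Fin n)) :=
  {x | R < ‖x‖}

/-- `f` is a (classical, complex-valued) solution of the Helmholtz equation `Δ f = -μ f`
in the open set `U`. -/
def IsHelmholtzSolutionOn {n : ℕ} (μ : ℝ) (f : EuclideanSpace ℝ (Fin n) → ℂ)
    (U : Set (EuclideanSpace ℝ (Fin n))) : Prop :=
  ContDiffOn ℝ 2 f U ∧ ∀ x ∈ U, Laplacian.laplacian f x = -(μ : ℂ) * f x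

/-- The integral `∫_U |f|^p dx ∈ [0, ∞]` with respect to Lebesgue measure. -/
def pIntegral {n : ℕ} (p : ℝ) (f : EuclideanSpace ℝ (Fin n) → ℂ)
    (U : Set (EuclideanSpace ℝ (Fin n))) : ℝ≥0∞ :=
  ∫⁻ x in U, ‖f x‖ₑ ^ p

/-- The Bessel function of the first kind
`J_ν(r) = ∑_k (-1)^k / (k! Γ(k + ν + 1)) (r / 2)^(2 k + ν)`, for real order `ν` and `r > 0`. -/
def besselJ (ν r : ℝ) : ℝ :=
  ∑' k : ℕ, (-1) ^ k / ((k.factorial : ℝ) * Real.Gamma (k + ν + 1)) *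
    (r / 2) ^ (2 * (k : ℝ) + ν)

/-- The spherically symmetric function `|x|^(-(n-2)/2) J_{(n-2)/2}(√μ |x|)`, for `x ≠ 0`. -/
def helmholtzBessel (n : ℕ) (μ : ℝ) (x : EuclideanSpace ℝ (Fin n)) : ℂ :=
  ((‖x‖ ^ (-(((n : ℝ) - 2) / 2)) * besselJ (((n : ℝ) - 2) / 2) (√μ * ‖x‖) : ℝ) : ℂ)

end

/-! Part (i) tests `f` on spheres against a smooth homogeneous `Q` of degree `k`, through the moment
`u(r) = ∫ f(rω) Q(ω) dσ(ω)`. The angular Laplacian is half the sum of squares of rotation fields.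
Such fields integrate to zero over spheres because the surface measure is rotation invariant, so the
angular Laplacian is symmetric there (`integral_sphere_angularLaplacian_mul`). Hence `u` satisfies
the radial Helmholtz equation, with the moment of `ΔQ` as source (`sphericalMoment_equation`). Since
`ΔQ` has degree `k - 2`, strong induction on `k` removes the source, and no theory of spherical
harmonics is needed.

With `w = r^((d-1)/2) u` the equation becomes `w'' + (μ - C/r²) w = 0`. The energy `|w'|² + μ|w|²`
changes by a bounded factor, as `1/r²` is integrable at infinity, so a nonzero solution keeps its
energy bounded above and below. For `p ≥ 1` the hypothesis on `f` gives `∫ |w|^p dr/r < ∞` exactly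
when the powers of `r` match, `(d-1)p/2 ≤ d`. Comparing kinetic and potential energy through the
derivative of `⟨w, w'⟩` shows that a nonzero `w` would make this integral dominate a logarithm, so
`w = 0` (`eq_zero_of_integrableOn`). All moments vanish, and Stone-Weierstrass gives `f = 0` on each
sphere.

For `p < 1` a moment is not controlled by the `L^p` norm. A mean value inequality on balls of fixed
radius, which self-improves to small exponents, first shows that `f` is bounded and therefore
integrable near infinity; this reduces to `p = 1`.

In part (ii) the Bessel function, divided by its power of `|x|`, is an entire series in `|x|²`. The
upper energy bound gives the decay `|x|^(-(n-1)/2)`, which is `p`-integrable above the critical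
exponent. The lower energy bound forbids vanishing near infinity, since the zero would propagate
back to the origin. -/

/-! ### Differentiation of integrals over a compact space. -/

open Metric Set in
/-- Differentiation under the integral sign over a compact space. -/
theorem hasDerivAt_integral_of_compactSpace {K : Type*} [TopologicalSpace K] [CompactSpace K]
    [MeasurableSpace K] [OpensMeasurableSpace K] {σ : Measure K} [IsFiniteMeasure σ]
    {F F' : ℝ → K → ℂ} {I : Set ℝ} (hI : IsOpen I)
    (hF : ∀ t ∈ I, Continuous (F t))
    (hF' : ContinuousOn (fun z : ℝ × K => F' z.1 z.2) (I ×ˢ univ))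
    (h : ∀ t ∈ I, ∀ ω, HasDerivAt (fun s => F s ω) (F' t ω) t) {t : ℝ} (ht : t ∈ I) :
    HasDerivAt (fun s => ∫ ω, F s ω ∂σ) (∫ ω, F' t ω ∂σ) t := by
  obtain ⟨ε, hε, hεI⟩ := Metric.nhds_basis_closedBall.mem_iff.1 (hI.mem_nhds ht)
  have hc : IsCompact (closedBall t ε ×ˢ (univ : Set K)) :=
    (isCompact_closedBall t ε).prod isCompact_univ
  obtain ⟨C, hC⟩ := hc.exists_bound_of_continuousOn
    (hF'.mono (prod_mono hεI subset_rfl))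
  have hcs : ∀ g : K → ℂ, Continuous g → AEStronglyMeasurable g σ := fun g hg =>
    hg.aestronglyMeasurable
  have hint : ∀ g : K → ℂ, Continuous g → Integrable g σ := fun g hg => by
    obtain ⟨D, hD⟩ := isCompact_univ.exists_bound_of_continuousOn hg.continuousOn
    exact Integrable.of_bound (hcs g hg) D (Filter.Eventually.of_forall fun x => hD x (mem_univ x))
  have hF't : Continuous (F' t) := by
    have : ContinuousOn (F' t) univ :=
      hF'.comp (f := fun ω : K => (t, ω)) (by fun_prop) (fun ω _ => ⟨ht, mem_univ _⟩)
    exact continuousOn_univ.1 this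
  refine (hasDerivAt_integral_of_dominated_loc_of_deriv_le (bound := fun _ => C)
    (closedBall_mem_nhds t hε) ?_ (hint _ (hF t ht)) (hcs _ hF't) ?_ (integrable_const C) ?_).2
  · filter_upwards [hI.mem_nhds ht] with s hs using hcs _ (hF s hs)
  · exact Filter.Eventually.of_forall fun ω s hs => hC (s, ω) ⟨hs, mem_univ _⟩
  · exact Filter.Eventually.of_forall fun ω s hs => h s (hεI hs) ω

/-! ### Rotation invariance of the sphere measure and symmetry of the angular Laplacian. -/

section Sphere

variable {E : Type*} [NormedAddCommGroup E] [InnerProductSpace ℝ E] [FiniteDimensional ℝ E]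
  [MeasurableSpace E] [BorelSpace E]

open Metric Set
open scoped Pointwise

theorem Continuous.integrable_toSphere {F : Type*} [NormedAddCommGroup F]
    {g : sphere (0 : E) 1 → F} (hg : Continuous g) :
    Integrable g (volume : Measure E).toSphere := by
  obtain ⟨D, hD⟩ := isCompact_univ.exists_bound_of_continuousOn hg.continuousOn
  exact Integrable.of_bound hg.aestronglyMeasurable D
    (Filter.Eventually.of_forall fun x => hD x (mem_univ x))

/-- The measure on the unit sphere is invariant under linear isometries. -/
theorem integral_toSphere_comp_linearIsometryEquiv (L : E ≃ₗᵢ[ℝ] E) {g : E → ℂ} :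
    ∫ ω : sphere (0 : E) 1, g (L ω) ∂(volume : Measure E).toSphere =
      ∫ ω : sphere (0 : E) 1, g ω ∂(volume : Measure E).toSphere := by
  set T : sphere (0 : E) 1 → sphere (0 : E) 1 :=
    fun ω => ⟨L ω, by simp⟩ with hT
  have hTc : Continuous T := by fun_prop
  have hTe : MeasurableEmbedding T := by
    refine (hTc.isClosedEmbedding fun a b hab => ?_).measurableEmbedding
    exact Subtype.ext (L.injective (congrArg Subtype.val hab))
  have hmp : MeasurePreserving T (volume : Measure E).toSphere (volume : Measure E).toSphere := by
    refine ⟨hTc.measurable, ?_⟩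
    ext s hs
    rw [Measure.map_apply hTc.measurable hs, Measure.toSphere_apply' _ (hTc.measurable hs),
      Measure.toSphere_apply' _ hs]
    congr 1
    -- The sphere measure of `s` is a multiple of the volume of the cone over `s`; `L` preserves
    -- volume and carries cones to cones.
    rw [← L.measurePreserving.measure_preimage_emb L.toHomeomorph.measurableEmbedding
      (Ioo (0 : ℝ) 1 • ((Subtype.val : sphere (0 : E) 1 → E) '' s))]
    congr 1
    ext x
    simp only [mem_preimage, mem_smul, mem_image]
    constructor
    · rintro ⟨a, ha, y, ⟨ω, hω, rfl⟩, rfl⟩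
      exact ⟨a, ha, L ω, ⟨T ω, hω, rfl⟩, (L.map_smul a (ω : E)).symm⟩
    · rintro ⟨a, ha, y, ⟨ω, hω, rfl⟩, hx⟩
      refine ⟨a, ha, L.symm ω, ⟨⟨L.symm ω, by simp⟩, ?_, rfl⟩, ?_⟩
      · simpa [hT] using hω
      · apply L.injective
        rw [L.map_smul, L.apply_symm_apply]
        exact hx
  exact hmp.integral_comp hTe (fun ω : sphere (0 : E) 1 => g ω)

/-- The derivative along a rotation field integrates to zero over a sphere. -/
theorem integral_sphere_fderiv_skewAdjoint {A : E →L[ℝ] E} (hA : A ∈ skewAdjoint (E →L[ℝ] E))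
    {g : E → ℂ} {U : Set E} (hU : IsOpen U) (hg : ContDiffOn ℝ 1 g U) {r : ℝ}
    (hr : ∀ ω : sphere (0 : E) 1, r • (ω : E) ∈ U) :
    ∫ ω : sphere (0 : E) 1, fderiv ℝ g (r • (ω : E)) (A (r • (ω : E)))
      ∂(volume : Measure E).toSphere = 0 := by
  let +nondep : NormedAlgebra ℚ (E →L[ℝ] E) := NormedAlgebra.restrictScalars ℚ ℝ (E →L[ℝ] E)
  have hunit : ∀ t : ℝ, NormedSpace.exp (t • A) ∈ unitary (E →L[ℝ] E) := fun t =>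
    NormedSpace.exp_mem_unitary_of_mem_skewAdjoint (skewAdjoint.smul_mem t hA)
  have hexp : ∀ t : ℝ, HasDerivAt (fun u : ℝ => NormedSpace.exp (u • A))
      (NormedSpace.exp (t • A) * A) t := fun t => hasDerivAt_exp_smul_const A t
  have hec : Continuous fun u : ℝ => NormedSpace.exp (u • A) :=
    continuous_iff_continuousAt.2 fun t => (hexp t).continuousAt
  have hmem : ∀ (t : ℝ) (ω : sphere (0 : E) 1), r • (NormedSpace.exp (t • A)) (ω : E) ∈ U := by
    intro t ω
    refine hr ⟨(NormedSpace.exp (t • A)) (ω : E), ?_⟩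
    simpa using (Unitary.norm_map ⟨_, hunit t⟩ (ω : E)).trans (by simp)
  have hfd : ContinuousOn (fderiv ℝ g) U := hg.continuousOn_fderiv_of_isOpen hU le_rfl
  have key := hasDerivAt_integral_of_compactSpace (σ := (volume : Measure E).toSphere)
    (F := fun t ω => g (r • (NormedSpace.exp (t • A)) (ω : E)))
    (F' := fun t ω => fderiv ℝ g (r • (NormedSpace.exp (t • A)) (ω : E))
      (r • (NormedSpace.exp (t • A) * A) (ω : E))) isOpen_univ
    (fun t _ => ?_) ?_ ?_ (mem_univ (0 : ℝ))
  -- The integral does not change along the rotation group generated by `A`, so its derivative at `t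
  -- = 0`, which is the desired integral, is zero.
  · have hconst : ∀ t : ℝ, ∫ ω : sphere (0 : E) 1, g (r • (NormedSpace.exp (t • A)) (ω : E))
        ∂(volume : Measure E).toSphere =
        ∫ ω : sphere (0 : E) 1, g (r • (ω : E)) ∂(volume : Measure E).toSphere := fun t =>
      integral_toSphere_comp_linearIsometryEquiv
        (Unitary.linearIsometryEquiv ⟨_, hunit t⟩) (g := fun x => g (r • x))
    simp only [hconst] at key
    have := key.unique (hasDerivAt_const _ _)
    simpa using this
  · exact hg.continuousOn.comp_continuous (by fun_prop) (hmem t)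
  · refine ContinuousOn.clm_apply ?_ ?_
    · refine hfd.comp (Continuous.continuousOn ?_) fun z _ => hmem z.1 z.2
      exact ((hec.comp continuous_fst).clm_apply
        (continuous_subtype_val.comp continuous_snd)).const_smul r
    · refine Continuous.continuousOn ?_
      exact (((hec.comp continuous_fst).mul continuous_const).clm_apply
        (continuous_subtype_val.comp continuous_snd)).const_smul r
  · intro t _ ω
    have h1 : HasDerivAt (fun u : ℝ => r • (NormedSpace.exp (u • A)) (ω : E))
        (r • (NormedSpace.exp (t • A) * A) (ω : E)) t := by
      have := ((hexp t).clm_apply (hasDerivAt_const t (ω : E))).const_smul r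
      rw [map_zero, add_zero] at this
      exact this
    have h2 := ((hg.differentiableOn one_ne_zero).differentiableAt
      (hU.mem_nhds (hmem t ω))).hasFDerivAt
    exact h2.comp_hasDerivAt t h1

/-- Integration by parts along a rotation field on a sphere. -/
theorem integral_sphere_fderiv_skewAdjoint_mul {A : E →L[ℝ] E}
    (hA : A ∈ skewAdjoint (E →L[ℝ] E)) {f g : E → ℂ} {U : Set E} (hU : IsOpen U)
    (hf : ContDiffOn ℝ 1 f U) (hg : ContDiffOn ℝ 1 g U) {r : ℝ}
    (hr : ∀ ω : sphere (0 : E) 1, r • (ω : E) ∈ U) :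
    ∫ ω : sphere (0 : E) 1, fderiv ℝ f (r • (ω : E)) (A (r • (ω : E))) * g (r • (ω : E))
      ∂(volume : Measure E).toSphere =
    -∫ ω : sphere (0 : E) 1, f (r • (ω : E)) * fderiv ℝ g (r • (ω : E)) (A (r • (ω : E)))
      ∂(volume : Measure E).toSphere := by
  have h := integral_sphere_fderiv_skewAdjoint hA hU (hf.mul hg) hr
  have hc : Continuous fun ω : sphere (0 : E) 1 => r • (ω : E) := by fun_prop
  have hAc : Continuous fun ω : sphere (0 : E) 1 => A (r • (ω : E)) := by fun_prop
  have c1 := (((hf.continuousOn_fderiv_of_isOpen hU le_rfl).comp_continuous hc hr).clm_apply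
    hAc).mul (hg.continuousOn.comp_continuous hc hr)
  have c2 := (hf.continuousOn.comp_continuous hc hr).mul
    (((hg.continuousOn_fderiv_of_isOpen hU le_rfl).comp_continuous hc hr).clm_apply hAc)
  rw [eq_neg_iff_add_eq_zero, ← h]
  refine (integral_add c1.integrable_toSphere c2.integrable_toSphere).symm.trans ?_
  congr 1
  ext ω
  simp only [Pi.mul_apply, Function.comp_apply]
  have hn := hU.mem_nhds (hr ω)
  have d1 := ((hf.differentiableOn one_ne_zero).differentiableAt hn).hasFDerivAt
  have d2 := ((hg.differentiableOn one_ne_zero).differentiableAt hn).hasFDerivAt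
  rw [(d1.fun_mul d2).fderiv]
  simp
  ring

/-- The second derivative along a rotation field is symmetric on a sphere. -/
theorem integral_sphere_fderiv_fderiv_skewAdjoint_mul {A : E →L[ℝ] E}
    (hA : A ∈ skewAdjoint (E →L[ℝ] E)) {f g : E → ℂ} {U : Set E} (hU : IsOpen U)
    (hf : ContDiffOn ℝ 2 f U) (hg : ContDiffOn ℝ 2 g U) {r : ℝ}
    (hr : ∀ ω : sphere (0 : E) 1, r • (ω : E) ∈ U) :
    ∫ ω : sphere (0 : E) 1, (fderiv ℝ (fderiv ℝ f) (r • (ω : E)) (A (r • (ω : E)))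
        (A (r • (ω : E))) + fderiv ℝ f (r • (ω : E)) (A (A (r • (ω : E))))) * g (r • (ω : E))
      ∂(volume : Measure E).toSphere =
    ∫ ω : sphere (0 : E) 1, f (r • (ω : E)) * (fderiv ℝ (fderiv ℝ g) (r • (ω : E))
        (A (r • (ω : E))) (A (r • (ω : E))) + fderiv ℝ g (r • (ω : E)) (A (A (r • (ω : E)))))
      ∂(volume : Measure E).toSphere := by
  have hD : ∀ {h : E → ℂ}, ContDiffOn ℝ 2 h U →
      ContDiffOn ℝ 1 (fun x => fderiv ℝ h x (A x)) U ∧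
      ∀ x ∈ U, fderiv ℝ (fun y => fderiv ℝ h y (A y)) x (A x) =
        fderiv ℝ (fderiv ℝ h) x (A x) (A x) + fderiv ℝ h x (A (A x)) := by
    intro h hh
    have h1 : ContDiffOn ℝ 1 (fderiv ℝ h) U := hh.fderiv_of_isOpen hU (by norm_num)
    refine ⟨h1.clm_apply A.contDiff.contDiffOn, fun x hx => ?_⟩
    have d1 := ((h1.differentiableOn one_ne_zero).differentiableAt (hU.mem_nhds hx)).hasFDerivAt
    rw [(d1.clm_apply A.hasFDerivAt).fderiv]
    simp [add_comm]
  have e1 := integral_sphere_fderiv_skewAdjoint_mul hA hU (hD hf).1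
    (hg.of_le (by norm_num)) hr
  have e2 := integral_sphere_fderiv_skewAdjoint_mul hA hU
    (hf.of_le (by norm_num)) (hD hg).1 hr
  rw [e2] at e1
  rw [neg_neg] at e1
  simpa only [(hD hf).2 _ (hr _), (hD hg).2 _ (hr _)] using e1

/-- The infinitesimal rotation `x ↦ ⟪a, x⟫ b - ⟪b, x⟫ a`. -/
noncomputable def infinitesimalRotation (a b : E) : E →L[ℝ] E :=
  (innerSL ℝ a).smulRight b - (innerSL ℝ b).smulRight a

omit [FiniteDimensional ℝ E] [MeasurableSpace E] [BorelSpace E] in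
theorem infinitesimalRotation_apply (a b x : E) :
    infinitesimalRotation a b x = inner ℝ a x • b - inner ℝ b x • a := by
  simp [infinitesimalRotation]

omit [MeasurableSpace E] [BorelSpace E] in
theorem infinitesimalRotation_mem_skewAdjoint (a b : E) :
    infinitesimalRotation a b ∈ skewAdjoint (E →L[ℝ] E) := by
  rw [skewAdjoint.mem_iff, ContinuousLinearMap.star_eq_adjoint]
  symm
  rw [ContinuousLinearMap.eq_adjoint_iff]
  intro x y
  simp only [neg_apply, infinitesimalRotation_apply, inner_neg_left,
    inner_sub_left, inner_sub_right, real_inner_smul_left, real_inner_smul_right]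
  rw [real_inner_comm x a, real_inner_comm x b]
  ring

omit [FiniteDimensional ℝ E] [MeasurableSpace E] [BorelSpace E] in
/-- The sum of the squares of all infinitesimal rotations is twice the angular part of the
Laplacian. -/
theorem sum_infinitesimalRotation {ι : Type*} [Fintype ι] (b : OrthonormalBasis ι ℝ E)
    (B : E →L[ℝ] E →L[ℝ] ℂ) (l : E →L[ℝ] ℂ) (x : E) :
    ∑ i, ∑ j, (B (infinitesimalRotation (b i) (b j) x) (infinitesimalRotation (b i) (b j) x)
      + l (infinitesimalRotation (b i) (b j) (infinitesimalRotation (b i) (b j) x))) =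
    2 * ((‖x‖ : ℂ) ^ 2 * ∑ i, B (b i) (b i) - B x x - ((Fintype.card ι : ℂ) - 1) * l x) := by
  classical
  have hx : x = ∑ i, inner ℝ (b i) x • b i := (b.sum_repr' x).symm
  set c : ι → ℝ := fun i => inner ℝ (b i) x with hc
  have hn : ((‖x‖ : ℂ)) ^ 2 = ∑ i, (c i : ℂ) * c i := by
    have := b.sum_sq_inner_right x
    rw [← Complex.ofReal_pow, ← this]
    push_cast
    exact Finset.sum_congr rfl fun i _ => by ring
  have hl : l x = ∑ i, (c i : ℂ) * l (b i) := by
    conv_lhs => rw [hx]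
    simp [hc]
  have hB : B x x = ∑ i, ∑ j, (c i : ℂ) * (c j * B (b i) (b j)) := by
    conv_lhs => rw [hx]
    simp only [map_sum, map_smul, sum_apply, smul_apply, Complex.real_smul, Finset.mul_sum, hc]
    rw [Finset.sum_comm]
    exact Finset.sum_congr rfl fun i _ => Finset.sum_congr rfl fun j _ => by ring
  -- No symmetry of `B` is needed: the two mixed terms are kept apart, and each sums to `B x x`.
  have hterm : ∀ i j, (B (infinitesimalRotation (b i) (b j) x)
        (infinitesimalRotation (b i) (b j) x)
      + l (infinitesimalRotation (b i) (b j) (infinitesimalRotation (b i) (b j) x))) =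
      (c i : ℂ) * c i * B (b j) (b j) - c i * (c j * B (b j) (b i)) - c j * (c i * B (b i) (b j))
      + c j * c j * B (b i) (b i) + ((if i = j then 1 else 0) * (c i * l (b j) + c j * l (b i))
        - c i * l (b i) - c j * l (b j)) := by
    intro i j
    have hij := orthonormal_iff_ite.1 b.orthonormal
    simp only [infinitesimalRotation_apply, inner_sub_right, real_inner_smul_right, hij]
    change B (c i • b j - c j • b i) (c i • b j - c j • b i) + _ = _
    by_cases h : i = j
    · subst h
      simp
      ring
    · simp [h, Ne.symm h]
      ring
  have hδ : ∑ i, ∑ j, (if i = j then (1 : ℂ) else 0) * (c i * l (b j) + c j * l (b i)) =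
      2 * l x := by
    simp [hl, Finset.mul_sum, two_mul]
  have h1 : ∑ i, ∑ j, (c i : ℂ) * c i * B (b j) (b j) = (‖x‖ : ℂ) ^ 2 * ∑ i, B (b i) (b i) := by
    rw [hn, Finset.sum_mul_sum]
  have h2 : ∑ i, ∑ j, (c j : ℂ) * c j * B (b i) (b i) = (‖x‖ : ℂ) ^ 2 * ∑ i, B (b i) (b i) := by
    rw [Finset.sum_comm, h1]
  have h3 : ∑ i, ∑ j, (c i : ℂ) * (c j * B (b j) (b i)) = B x x := by
    rw [Finset.sum_comm, hB]
    exact Finset.sum_congr rfl fun i _ => Finset.sum_congr rfl fun j _ => by ring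
  have h4 : ∑ i, ∑ j, (c j : ℂ) * (c i * B (b i) (b j)) = B x x := by
    rw [hB]
    exact Finset.sum_congr rfl fun i _ => Finset.sum_congr rfl fun j _ => by ring
  have h5 : ∑ i, ∑ _j : ι, (c i : ℂ) * l (b i) = Fintype.card ι * l x := by
    simp [hl, Finset.mul_sum]
  have h6 : ∑ _i : ι, ∑ j, (c j : ℂ) * l (b j) = Fintype.card ι * l x := by
    rw [Finset.sum_comm, h5]
  simp only [hterm, Finset.sum_add_distrib, Finset.sum_sub_distrib] at h1 h2 h3 h4 h5 h6 hδ ⊢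
  rw [h1, h2, h3, h4, h5, h6, hδ]
  ring

omit [MeasurableSpace E] [BorelSpace E] in
theorem laplacian_eq_sum_fderiv_fderiv {ι : Type*} [Fintype ι] (b : OrthonormalBasis ι ℝ E)
    (f : E → ℂ) (x : E) :
    Laplacian.laplacian f x = ∑ i, fderiv ℝ (fderiv ℝ f) x (b i) (b i) := by
  rw [InnerProductSpace.laplacian_eq_iteratedFDeriv_orthonormalBasis f b]
  simp [iteratedFDeriv_two_apply]

/-- `r²` times the angular part of the Laplacian. -/
noncomputable def angularLaplacian (f : E → ℂ) (x : E) : ℂ :=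
  (‖x‖ : ℂ) ^ 2 * Laplacian.laplacian f x - fderiv ℝ (fderiv ℝ f) x x x -
    ((Module.finrank ℝ E : ℂ) - 1) * fderiv ℝ f x x

/-- The angular Laplacian is symmetric on spheres. -/
theorem integral_sphere_angularLaplacian_mul {f g : E → ℂ} {U : Set E} (hU : IsOpen U)
    (hf : ContDiffOn ℝ 2 f U) (hg : ContDiffOn ℝ 2 g U) {r : ℝ}
    (hr : ∀ ω : sphere (0 : E) 1, r • (ω : E) ∈ U) :
    ∫ ω : sphere (0 : E) 1, angularLaplacian f (r • (ω : E)) * g (r • (ω : E))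
      ∂(volume : Measure E).toSphere =
    ∫ ω : sphere (0 : E) 1, f (r • (ω : E)) * angularLaplacian g (r • (ω : E))
      ∂(volume : Measure E).toSphere := by
  set b := stdOrthonormalBasis ℝ E
  -- The factor `2⁻¹` appears because the double sum counts each coordinate plane twice.
  have hang : ∀ (h : E → ℂ) (x : E), angularLaplacian h x = 2⁻¹ * ∑ i, ∑ j,
      (fderiv ℝ (fderiv ℝ h) x (infinitesimalRotation (b i) (b j) x)
        (infinitesimalRotation (b i) (b j) x) + fderiv ℝ h x
          (infinitesimalRotation (b i) (b j) (infinitesimalRotation (b i) (b j) x))) := by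
    intro h x
    rw [sum_infinitesimalRotation, angularLaplacian, laplacian_eq_sum_fderiv_fderiv b]
    simp
  have hc : Continuous fun ω : sphere (0 : E) 1 => r • (ω : E) := by fun_prop
  have hcont : ∀ {h : E → ℂ}, ContDiffOn ℝ 2 h U → ∀ A : E →L[ℝ] E,
      Continuous fun ω : sphere (0 : E) 1 => fderiv ℝ (fderiv ℝ h) (r • (ω : E)) (A (r • (ω : E)))
        (A (r • (ω : E))) + fderiv ℝ h (r • (ω : E)) (A (A (r • (ω : E)))) := by
    intro h hh A
    have h1 : ContDiffOn ℝ 1 (fderiv ℝ h) U := hh.fderiv_of_isOpen hU (by norm_num)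
    have c1 := h1.continuousOn.comp_continuous hc hr
    have c2 := (h1.continuousOn_fderiv_of_isOpen hU le_rfl).comp_continuous hc hr
    exact ((c2.clm_apply (A.continuous.comp hc)).clm_apply (A.continuous.comp hc)).add
      (c1.clm_apply (A.continuous.comp (A.continuous.comp hc)))
  have cf := hf.continuousOn.comp_continuous hc hr
  have cg := hg.continuousOn.comp_continuous hc hr
  simp only [hang, mul_assoc, mul_left_comm _ (2⁻¹ : ℂ), integral_const_mul]
  congr 1
  simp only [Finset.sum_mul, Finset.mul_sum]
  rw [integral_finsetSum, integral_finsetSum]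
  · refine Finset.sum_congr rfl fun i _ => ?_
    rw [integral_finsetSum, integral_finsetSum]
    · exact Finset.sum_congr rfl fun j _ => integral_sphere_fderiv_fderiv_skewAdjoint_mul
        (infinitesimalRotation_mem_skewAdjoint _ _) hU hf hg hr
    · exact fun j _ => (cf.mul (hcont hg _)).integrable_toSphere
    · exact fun j _ => ((hcont hf _).mul cg).integrable_toSphere
  · exact fun i _ => integrable_finsetSum _ fun j _ => (cf.mul (hcont hg _)).integrable_toSphere
  · exact fun i _ => integrable_finsetSum _ fun j _ => ((hcont hf _).mul cg).integrable_toSphere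

end Sphere

/-! ### Homogeneous functions and the radial equation of spherical moments. -/

section Sphere

variable {E : Type*} [NormedAddCommGroup E] [InnerProductSpace ℝ E] 

open Metric Set

/-- A smooth function which is positively homogeneous of degree `k` (that is, a homogeneous
polynomial function of degree `k`). -/
structure IsSmoothHomogeneous (k : ℕ) (Q : E → ℂ) : Prop where
  contDiff : ContDiff ℝ (⊤ : ℕ∞) Q
  map_smul : ∀ t : ℝ, 0 < t → ∀ x, Q (t • x) = (t : ℂ) ^ k * Q x

namespace IsSmoothHomogeneous

variable {k : ℕ} {Q : E → ℂ}

theorem contDiff_fderiv (hQ : IsSmoothHomogeneous k Q) : ContDiff ℝ (⊤ : ℕ∞) (fderiv ℝ Q) :=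
  hQ.contDiff.fderiv_right (by simp)

variable [FiniteDimensional ℝ E]

theorem contDiff_laplacian (hQ : IsSmoothHomogeneous k Q) :
    ContDiff ℝ (⊤ : ℕ∞) (Laplacian.laplacian Q) := by
  have h2 : ContDiff ℝ (⊤ : ℕ∞) (fderiv ℝ (fderiv ℝ Q)) :=
    hQ.contDiff_fderiv.fderiv_right (by simp)
  have : Laplacian.laplacian Q = fun x => ∑ i, fderiv ℝ (fderiv ℝ Q) x
      (stdOrthonormalBasis ℝ E i) (stdOrthonormalBasis ℝ E i) := by
    ext x
    exact laplacian_eq_sum_fderiv_fderiv _ Q x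
  rw [this]
  exact ContDiff.sum fun i _ => (h2.clm_apply contDiff_const).clm_apply contDiff_const

omit [FiniteDimensional ℝ E] in
theorem fderiv_smul (hQ : IsSmoothHomogeneous k Q) {t : ℝ} (ht : 0 < t) (x : E) :
    t • fderiv ℝ Q (t • x) = t ^ k • fderiv ℝ Q x := by
  have h : (fun x => Q (t • x)) = fun x => t ^ k • Q x := by
    ext x
    simp [hQ.map_smul t ht x]
  have h1 := congrArg (fun g => fderiv ℝ g x) h
  beta_reduce at h1
  rw [fderiv_comp_smul, fderiv_fun_const_smul] at h1
  · exact h1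
  · exact hQ.contDiff.differentiable (by simp) x

omit [FiniteDimensional ℝ E] in
theorem fderiv_fderiv_smul (hQ : IsSmoothHomogeneous k Q) {t : ℝ} (ht : 0 < t) (x : E) :
    t ^ 2 • fderiv ℝ (fderiv ℝ Q) (t • x) = t ^ k • fderiv ℝ (fderiv ℝ Q) x := by
  have h : (fun x => t • fderiv ℝ Q (t • x)) = fun x => t ^ k • fderiv ℝ Q x := by
    ext1 x
    exact hQ.fderiv_smul ht x
  have h1 := congrArg (fun g => fderiv ℝ g x) h
  have hd : Differentiable ℝ (fderiv ℝ Q) := hQ.contDiff_fderiv.differentiable (by simp)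
  beta_reduce at h1
  have hd' : Differentiable ℝ fun x => fderiv ℝ Q (t • x) :=
    hd.comp (differentiable_id.const_smul t)
  rw [fderiv_fun_const_smul (hd' x) t, fderiv_fun_const_smul (hd x) (t ^ k),
    fderiv_comp_smul] at h1
  rw [← h1, sq, mul_smul]

theorem laplacian_smul (hQ : IsSmoothHomogeneous k Q) {t : ℝ} (ht : 0 < t) (x : E) :
    (t : ℂ) ^ 2 * Laplacian.laplacian Q (t • x) = (t : ℂ) ^ k * Laplacian.laplacian Q x := by
  rw [laplacian_eq_sum_fderiv_fderiv (stdOrthonormalBasis ℝ E),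
    laplacian_eq_sum_fderiv_fderiv (stdOrthonormalBasis ℝ E), Finset.mul_sum, Finset.mul_sum]
  refine Finset.sum_congr rfl fun i _ => ?_
  have := congrArg (fun B : E →L[ℝ] E →L[ℝ] ℂ => B (stdOrthonormalBasis ℝ E i)
    (stdOrthonormalBasis ℝ E i)) (hQ.fderiv_fderiv_smul ht x)
  simpa using this

theorem laplacian (hQ : IsSmoothHomogeneous (k + 2) Q) :
    IsSmoothHomogeneous k (Laplacian.laplacian Q) := by
  refine ⟨hQ.contDiff_laplacian, fun t ht x => ?_⟩
  have h := hQ.laplacian_smul ht x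
  have ht' : (t : ℂ) ^ 2 ≠ 0 := by simp [ht.ne']
  apply mul_left_cancel₀ ht'
  rw [h]
  ring

/-- A second derivative of `Q` would have negative degree `k - 2`, yet it is continuous at the
origin: let `t → 0` in `t^(2-k) ΔQ(tx) = ΔQ(x)`. This is the base of the induction on the degree. -/
theorem laplacian_eq_zero (hQ : IsSmoothHomogeneous k Q) (hk : k < 2) (x : E) :
    Laplacian.laplacian Q x = 0 := by
  have h : ∀ t : ℝ, 0 < t →
      (t : ℂ) ^ (2 - k) * Laplacian.laplacian Q (t • x) = Laplacian.laplacian Q x := by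
    intro t ht
    have h := hQ.laplacian_smul ht x
    have ht' : (t : ℂ) ^ k ≠ 0 := by simp [ht.ne']
    apply mul_left_cancel₀ ht'
    rw [← h, ← mul_assoc, ← pow_add, Nat.add_sub_of_le hk.le]
  have hc : Continuous fun t : ℝ => (t : ℂ) ^ (2 - k) * Laplacian.laplacian Q (t • x) := by
    have := hQ.contDiff_laplacian.continuous
    fun_prop
  have h0 : Filter.Tendsto (fun t : ℝ => (t : ℂ) ^ (2 - k) * Laplacian.laplacian Q (t • x))
      (𝓝[>] 0) (𝓝 0) := by
    have := (hc.tendsto 0).mono_left (nhdsWithin_le_nhds (s := Ioi 0))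
    simpa [show 2 - k ≠ 0 by omega] using this
  refine tendsto_nhds_unique (tendsto_const_nhds.congr' ?_) h0
  filter_upwards [self_mem_nhdsWithin] with t ht using (h t ht).symm

omit [FiniteDimensional ℝ E] in
theorem fderiv_self (hQ : IsSmoothHomogeneous k Q) (x : E) : fderiv ℝ Q x x = k * Q x := by
  have h1 : HasDerivAt (fun t : ℝ => Q (t • x)) (fderiv ℝ Q x x) 1 := by
    have hd := (hQ.contDiff.differentiable (by simp) ((1 : ℝ) • x)).hasFDerivAt
    have := hd.comp_hasDerivAt (1 : ℝ) ((hasDerivAt_id (1 : ℝ)).smul_const x)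
    simpa [Function.comp_def] using this
  have h2 : HasDerivAt (fun t : ℝ => (t : ℂ) ^ k * Q x) (k * Q x) 1 := by
    have := ((hasDerivAt_id (1 : ℝ)).ofReal_comp.pow k).mul_const (Q x)
    simpa using this
  refine h1.unique (h2.congr_of_eventuallyEq ?_)
  filter_upwards [lt_mem_nhds (zero_lt_one' ℝ)] with t ht using hQ.map_smul t ht x

omit [FiniteDimensional ℝ E] in
theorem fderiv_fderiv_self (hQ : IsSmoothHomogeneous k Q) (x : E) :
    fderiv ℝ (fderiv ℝ Q) x x x = k * (k - 1) * Q x := by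
  have hd := (hQ.contDiff_fderiv.differentiable (by simp) x).hasFDerivAt
  have h1 := (hd.clm_apply (hasFDerivAt_id x)).fderiv
  have h2 : (fun y => (fderiv ℝ Q y) (id y)) = fun y => (k : ℂ) • Q y := by
    ext y
    simpa using hQ.fderiv_self y
  rw [h2, fderiv_fun_const_smul (hQ.contDiff.differentiable (by simp) x)] at h1
  have h3 := congrArg (fun l : E →L[ℝ] ℂ => l x) h1
  simp [hQ.fderiv_self] at h3
  linear_combination -h3

/-- Euler's identities turn the radial derivatives into multiples of `Q`, producing the usual
eigenvalue `k(k + d - 2)`. The term with `ΔQ` remains because `Q` is not assumed harmonic. -/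
theorem angularLaplacian_smul (hQ : IsSmoothHomogeneous k Q) {r : ℝ} (hr : 0 < r)
    (ω : sphere (0 : E) 1) :
    angularLaplacian Q (r • (ω : E)) = (r : ℂ) ^ k * (Laplacian.laplacian Q ω -
      k * (k + (Module.finrank ℝ E : ℂ) - 2) * Q ω) := by
  have h := hQ.laplacian_smul hr ω
  have hn : ‖r • (ω : E)‖ = r := by simp [norm_smul, abs_of_pos hr]
  rw [angularLaplacian, hQ.fderiv_fderiv_self, hQ.fderiv_self, hQ.map_smul r hr, hn, h]
  ring

end IsSmoothHomogeneous

variable [FiniteDimensional ℝ E] [MeasurableSpace E] [BorelSpace E]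

/-- The `k`-th spherical moment of a function on the sphere of radius `r`. -/
noncomputable def sphericalMoment (f Q : E → ℂ) (r : ℝ) : ℂ :=
  ∫ ω : sphere (0 : E) 1, f (r • (ω : E)) * Q ω ∂(volume : Measure E).toSphere

section Moment

variable {f Q : E → ℂ} {U : Set E} {I : Set ℝ}

theorem hasDerivAt_sphericalMoment (hU : IsOpen U) (hI : IsOpen I)
    (hIU : ∀ r ∈ I, ∀ ω : sphere (0 : E) 1, r • (ω : E) ∈ U) (hf : ContDiffOn ℝ 1 f U)
    (hQ : Continuous Q) {r : ℝ} (hr : r ∈ I) :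
    HasDerivAt (sphericalMoment f Q) (∫ ω : sphere (0 : E) 1, fderiv ℝ f (r • (ω : E)) ω * Q ω
      ∂(volume : Measure E).toSphere) r := by
  refine hasDerivAt_integral_of_compactSpace
    (F := fun r (ω : sphere (0 : E) 1) => f (r • (ω : E)) * Q ω)
    (F' := fun r ω => fderiv ℝ f (r • (ω : E)) ω * Q ω) hI (fun t ht => ?_) ?_ ?_ hr
  · exact (hf.continuousOn.comp_continuous (by fun_prop) (hIU t ht)).mul (by fun_prop)
  · refine ContinuousOn.mul (ContinuousOn.clm_apply ?_ ?_) ?_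
    · exact (hf.continuousOn_fderiv_of_isOpen hU le_rfl).comp
        (Continuous.continuousOn (by fun_prop)) fun z hz => hIU z.1 hz.1 z.2
    · exact Continuous.continuousOn (by fun_prop)
    · exact Continuous.continuousOn (by fun_prop)
  · intro t ht ω
    have hd := ((hf.differentiableOn one_ne_zero).differentiableAt
      (hU.mem_nhds (hIU t ht ω))).hasFDerivAt
    have := (hd.comp_hasDerivAt t ((hasDerivAt_id t).smul_const (ω : E))).mul_const (Q ω)
    simpa using this

theorem hasDerivAt_sphericalMoment_fderiv (hU : IsOpen U) (hI : IsOpen I)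
    (hIU : ∀ r ∈ I, ∀ ω : sphere (0 : E) 1, r • (ω : E) ∈ U) (hf : ContDiffOn ℝ 2 f U)
    (hQ : Continuous Q) {r : ℝ} (hr : r ∈ I) :
    HasDerivAt (fun r : ℝ => ∫ ω : sphere (0 : E) 1, fderiv ℝ f (r • (ω : E)) ω * Q ω
        ∂(volume : Measure E).toSphere)
      (∫ ω : sphere (0 : E) 1, fderiv ℝ (fderiv ℝ f) (r • (ω : E)) ω ω * Q ω
        ∂(volume : Measure E).toSphere) r := by
  have hf1 : ContDiffOn ℝ 1 (fderiv ℝ f) U := hf.fderiv_of_isOpen hU (by norm_num)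
  refine hasDerivAt_integral_of_compactSpace
    (F := fun r (ω : sphere (0 : E) 1) => fderiv ℝ f (r • (ω : E)) ω * Q ω)
    (F' := fun r ω => fderiv ℝ (fderiv ℝ f) (r • (ω : E)) ω ω * Q ω) hI (fun t ht => ?_) ?_ ?_ hr
  · exact ((hf1.continuousOn.comp_continuous (by fun_prop) (hIU t ht)).clm_apply
      (by fun_prop)).mul (by fun_prop)
  · refine ContinuousOn.mul (ContinuousOn.clm_apply (ContinuousOn.clm_apply ?_ ?_) ?_) ?_
    · exact (hf1.continuousOn_fderiv_of_isOpen hU le_rfl).comp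
        (Continuous.continuousOn (by fun_prop)) fun z hz => hIU z.1 hz.1 z.2
    · exact Continuous.continuousOn (by fun_prop)
    · exact Continuous.continuousOn (by fun_prop)
    · exact Continuous.continuousOn (by fun_prop)
  · intro t ht ω
    have hd := ((hf1.differentiableOn one_ne_zero).differentiableAt
      (hU.mem_nhds (hIU t ht ω))).hasFDerivAt
    have h1 := hd.comp_hasDerivAt t ((hasDerivAt_id t).smul_const (ω : E))
    have := (h1.clm_apply (hasDerivAt_const t (ω : E))).mul_const (Q ω)
    simpa using this

/-- The spherical moments of a solution of the Helmholtz equation satisfy a radial equation. -/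
theorem sphericalMoment_equation {μ : ℝ} {k : ℕ} (hU : IsOpen U) (hf : ContDiffOn ℝ 2 f U)
    (hH : ∀ x ∈ U, Laplacian.laplacian f x = -(μ : ℂ) * f x) (hQ : IsSmoothHomogeneous k Q)
    {r : ℝ} (hr : 0 < r) (hrU : ∀ ω : sphere (0 : E) 1, r • (ω : E) ∈ U) :
    (r : ℂ) ^ 2 * ∫ ω : sphere (0 : E) 1, fderiv ℝ (fderiv ℝ f) (r • (ω : E)) ω ω * Q ω
        ∂(volume : Measure E).toSphere +
      ((Module.finrank ℝ E : ℂ) - 1) * r * ∫ ω : sphere (0 : E) 1,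
        fderiv ℝ f (r • (ω : E)) ω * Q ω ∂(volume : Measure E).toSphere +
      (μ * (r : ℂ) ^ 2 - k * (k + (Module.finrank ℝ E : ℂ) - 2)) * sphericalMoment f Q r =
    -sphericalMoment f (Laplacian.laplacian Q) r := by
  have hf1 : ContDiffOn ℝ 1 (fderiv ℝ f) U := hf.fderiv_of_isOpen hU (by norm_num)
  have hc : Continuous fun ω : sphere (0 : E) 1 => r • (ω : E) := by fun_prop
  have hv : Continuous fun ω : sphere (0 : E) 1 => (ω : E) := by fun_prop
  have hQc : Continuous fun ω : sphere (0 : E) 1 => Q ω := hQ.contDiff.continuous.comp hv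
  have hLc : Continuous fun ω : sphere (0 : E) 1 => Laplacian.laplacian Q ω :=
    hQ.contDiff_laplacian.continuous.comp hv
  have cf := hf.continuousOn.comp_continuous hc hrU
  have c1 := (hf1.continuousOn.comp_continuous hc hrU).clm_apply hv
  have c2 := (((hf1.continuousOn_fderiv_of_isOpen hU le_rfl).comp_continuous hc hrU).clm_apply
    hv).clm_apply hv
  have i0 := (cf.mul hQc).integrable_toSphere
  have i1 := (c1.mul hQc).integrable_toSphere
  have i2 := (c2.mul hQc).integrable_toSphere
  have i3 := (cf.mul hLc).integrable_toSphere
  have h := integral_sphere_angularLaplacian_mul hU hf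
    (hQ.contDiff.of_le (WithTop.coe_le_coe.2 le_top)).contDiffOn hrU
  -- The symmetry identity involves `Q` at `rω`, the moments involve `Q` at `ω`; by homogeneity this
  -- costs a common factor `r^k`, which is cancelled.
  have hr' : (r : ℂ) ^ k ≠ 0 := by simp [hr.ne']
  have e1 : ∀ ω : sphere (0 : E) 1, angularLaplacian f (r • (ω : E)) * Q (r • (ω : E)) =
      (r : ℂ) ^ k * (-(μ * (r : ℂ) ^ 2) * (f (r • (ω : E)) * Q ω)
        - (r : ℂ) ^ 2 * (fderiv ℝ (fderiv ℝ f) (r • (ω : E)) ω ω * Q ω)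
        - ((Module.finrank ℝ E : ℂ) - 1) * r * (fderiv ℝ f (r • (ω : E)) ω * Q ω)) := by
    intro ω
    have hn : ‖r • (ω : E)‖ = r := by simp [norm_smul, abs_of_pos hr]
    rw [angularLaplacian, hH _ (hrU ω), hQ.map_smul r hr, hn]
    simp only [map_smul, smul_apply, Complex.real_smul]
    ring
  have e2 : ∀ ω : sphere (0 : E) 1, f (r • (ω : E)) * angularLaplacian Q (r • (ω : E)) =
      (r : ℂ) ^ k * (f (r • (ω : E)) * Laplacian.laplacian Q ω -
        k * (k + (Module.finrank ℝ E : ℂ) - 2) * (f (r • (ω : E)) * Q ω)) := by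
    intro ω
    rw [hQ.angularLaplacian_smul hr]
    ring
  simp only [e1, e2, integral_const_mul] at h
  have h' := mul_left_cancel₀ hr' h
  have s1 := integral_sub (i3) (i0.const_mul (k * (k + (Module.finrank ℝ E : ℂ) - 2)))
  have s2 := integral_sub ((i0.const_mul (-(μ * (r : ℂ) ^ 2))).sub (i2.const_mul ((r : ℂ) ^ 2)))
    (i1.const_mul (((Module.finrank ℝ E : ℂ) - 1) * r))
  have s3 := integral_sub (i0.const_mul (-(μ * (r : ℂ) ^ 2))) (i2.const_mul ((r : ℂ) ^ 2))
  simp only [Pi.sub_apply, Pi.mul_apply, Function.comp_apply, integral_const_mul] at s1 s2 s3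
  rw [s1, s2, s3] at h'
  simp only [sphericalMoment]
  linear_combination -h'

end Moment

end Sphere

/-! ### Energy method for the perturbed oscillator. -/

section RadialEquation

open Set Filter

/-- `w` and its derivative `w'` solve `w'' + (μ - C / r²) w = 0` for `r > R`. -/
structure IsPerturbedOscillator (μ C R : ℝ) (w w' : ℝ → ℂ) : Prop where
  hasDerivAt : ∀ r, R < r → HasDerivAt w (w' r) r
  hasDerivAt' : ∀ r, R < r → HasDerivAt w' ((-(μ - C / r ^ 2) : ℝ) • w r) r

/-- The energy `|w'|² + μ |w|²`. -/
noncomputable def oscillatorEnergy (μ : ℝ) (w w' : ℝ → ℂ) (r : ℝ) : ℝ := ‖w' r‖ ^ 2 + μ * ‖w r‖ ^ 2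

variable {μ C R : ℝ} {w w' : ℝ → ℂ}

theorem oscillatorEnergy_nonneg (hμ : 0 < μ) (r : ℝ) : 0 ≤ oscillatorEnergy μ w w' r := by
  unfold oscillatorEnergy
  positivity

theorem two_mul_norm_mul_norm_le_oscillatorEnergy (hμ : 0 < μ) (r : ℝ) :
    2 * (‖w r‖ * ‖w' r‖) ≤ oscillatorEnergy μ w w' r / √μ := by
  have hs : 0 < √μ := Real.sqrt_pos.2 hμ
  have hs2 : √μ ^ 2 = μ := Real.sq_sqrt hμ.le
  rw [le_div_iff₀ hs, oscillatorEnergy]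
  nlinarith [sq_nonneg (‖w' r‖ - √μ * ‖w r‖)]

namespace IsPerturbedOscillator

/-- The contributions of `μ` from the two summands cancel, so only the potential `C/r²` changes the
energy. -/
theorem hasDerivAt_oscillatorEnergy (h : IsPerturbedOscillator μ C R w w') {r : ℝ} (hr : R < r) :
    HasDerivAt (oscillatorEnergy μ w w') (2 * C / r ^ 2 * inner ℝ (w r) (w' r)) r := by
  have h1 := (h.hasDerivAt' r hr).norm_sq.add ((h.hasDerivAt r hr).norm_sq.const_mul μ)
  refine h1.congr_deriv ?_
  rw [real_inner_smul_right, real_inner_comm (w' r) (w r)]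
  ring

theorem abs_deriv_oscillatorEnergy_le (hμ : 0 < μ) {r : ℝ} :
    |2 * C / r ^ 2 * inner ℝ (w r) (w' r)| ≤
      |C| / √μ / r ^ 2 * oscillatorEnergy μ w w' r := by
  have h1 := abs_real_inner_le_norm (w r) (w' r)
  have h2 := two_mul_norm_mul_norm_le_oscillatorEnergy (w := w) (w' := w') hμ r
  rw [abs_mul, abs_div, abs_mul, abs_two, abs_of_nonneg (sq_nonneg r)]
  calc 2 * |C| / r ^ 2 * |inner ℝ (w r) (w' r)| ≤ 2 * |C| / r ^ 2 * (‖w r‖ * ‖w' r‖) := by gcongr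
    _ = |C| / r ^ 2 * (2 * (‖w r‖ * ‖w' r‖)) := by ring
    _ ≤ |C| / r ^ 2 * (oscillatorEnergy μ w w' r / √μ) := by gcongr
    _ = _ := by ring

/-- A Grönwall argument: with `K = |C|/√μ` one has `|E'| ≤ K E / t²`, so `E exp(-K/t)` increases and
`E exp(K/t)` decreases. The bounds are uniform in `s`. The upper one gives decay of solutions, the
lower one unique continuation in both directions. -/
theorem oscillatorEnergy_bounds (h : IsPerturbedOscillator μ C R w w') (hμ : 0 < μ) (hR : 0 ≤ R)
    {r s : ℝ} (hr : R < r) (hrs : r ≤ s) :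
    oscillatorEnergy μ w w' r * Real.exp (-(|C| / √μ / r)) ≤ oscillatorEnergy μ w w' s ∧
    oscillatorEnergy μ w w' s ≤ oscillatorEnergy μ w w' r * Real.exp (|C| / √μ / r) := by
  set K := |C| / √μ with hK
  have hK0 : 0 ≤ K := by positivity
  have hs0 : 0 < s := by linarith
  have hexp : ∀ σ : ℝ, ∀ t, R < t →
      HasDerivAt (fun t => oscillatorEnergy μ w w' t * Real.exp (σ * (K / t)))
      (Real.exp (σ * (K / t)) * (2 * C / t ^ 2 * inner ℝ (w t) (w' t)
        - σ * (K / t ^ 2 * oscillatorEnergy μ w w' t))) t := by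
    intro σ t ht
    have ht0 : t ≠ 0 := by linarith
    have h1 : HasDerivAt (fun t : ℝ => σ * (K / t)) (σ * (K * -(t ^ 2)⁻¹)) t := by
      simpa [div_eq_mul_inv] using ((hasDerivAt_inv ht0).const_mul K).const_mul σ
    refine ((h.hasDerivAt_oscillatorEnergy ht).mul h1.exp).congr_deriv ?_
    field_simp
    ring
  have hb : ∀ t, |2 * C / t ^ 2 * inner ℝ (w t) (w' t)| ≤ K / t ^ 2 * oscillatorEnergy μ w w' t :=
    fun t => abs_deriv_oscillatorEnergy_le hμ
  have hmem : ∀ t ∈ Ici r, R < t := fun t ht => lt_of_lt_of_le hr ht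
  have hmono : MonotoneOn (fun t => oscillatorEnergy μ w w' t * Real.exp (-1 * (K / t)))
      (Ici r) := by
    refine monotoneOn_of_hasDerivWithinAt_nonneg (convex_Ici r)
      (fun t ht => (hexp (-1) t (hmem t ht)).continuousAt.continuousWithinAt)
      (fun t ht => (hexp (-1) t (hmem t (interior_subset ht))).hasDerivWithinAt) fun t _ => ?_
    refine mul_nonneg (Real.exp_pos _).le ?_
    linarith [(abs_le.1 (hb t)).1]
  have hanti : AntitoneOn (fun t => oscillatorEnergy μ w w' t * Real.exp (1 * (K / t)))
      (Ici r) := by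
    refine antitoneOn_of_hasDerivWithinAt_nonpos (convex_Ici r)
      (fun t ht => (hexp 1 t (hmem t ht)).continuousAt.continuousWithinAt)
      (fun t ht => (hexp 1 t (hmem t (interior_subset ht))).hasDerivWithinAt) fun t _ => ?_
    refine mul_nonpos_of_nonneg_of_nonpos (Real.exp_pos _).le ?_
    linarith [(abs_le.1 (hb t)).2]
  have h1 := hmono self_mem_Ici (mem_Ici.2 hrs) hrs
  have h2 := hanti self_mem_Ici (mem_Ici.2 hrs) hrs
  simp only [neg_mul, one_mul] at h1 h2
  have hEs := oscillatorEnergy_nonneg (w := w) (w' := w') hμ s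
  have hKs : 0 ≤ K / s := by positivity
  constructor
  · refine h1.trans (mul_le_of_le_one_right hEs ?_)
    rw [Real.exp_le_one_iff]
    linarith
  · refine le_trans ?_ h2
    exact le_mul_of_one_le_right hEs (Real.one_le_exp hKs)

/-- A solution which is `L^p` for the measure `dr / r` near infinity vanishes. -/
theorem eq_zero_of_integrableOn (h : IsPerturbedOscillator μ C R w w') (hμ : 0 < μ) (hR : 0 ≤ R)
    {p b : ℝ} (hp : 0 < p) (hb : IntegrableOn (fun r => ‖w r‖ ^ p / r) (Ioi b)) {r : ℝ}
    (hr : R < r) : w r = 0 := by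
  suffices hE : oscillatorEnergy μ w w' r = 0 by
    unfold oscillatorEnergy at hE
    have h2 : μ * ‖w r‖ ^ 2 = 0 := by nlinarith [sq_nonneg ‖w' r‖, sq_nonneg ‖w r‖]
    simpa [hμ.ne'] using h2
  by_contra hne
  have hEpos : 0 < oscillatorEnergy μ w w' r :=
    lt_of_le_of_ne (oscillatorEnergy_nonneg hμ r) (Ne.symm hne)
  set K := |C| / √μ with hK
  set c := oscillatorEnergy μ w w' r * Real.exp (-(K / r)) with hc
  set B := oscillatorEnergy μ w w' r * Real.exp (K / r) with hB
  have hc0 : 0 < c := by positivity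
  have hB0 : 0 < B := by positivity
  have hsμ : 0 < √μ := Real.sqrt_pos.2 hμ
  set a := max (max r b) 1 with ha
  have ha1 : 1 ≤ a := le_max_right _ _
  have har : r ≤ a := (le_max_left _ _).trans (le_max_left _ _)
  have hab : b ≤ a := (le_max_right _ _).trans (le_max_left _ _)
  have hlow : ∀ t, a ≤ t → c ≤ oscillatorEnergy μ w w' t := fun t ht =>
    (h.oscillatorEnergy_bounds hμ hR hr (har.trans ht)).1
  have hup : ∀ t, a ≤ t → oscillatorEnergy μ w w' t ≤ B := fun t ht =>
    (h.oscillatorEnergy_bounds hμ hR hr (har.trans ht)).2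
  set B' := B / √μ with hB'
  have hww : ∀ t, a ≤ t → |inner ℝ (w t) (w' t)| ≤ B' := by
    intro t ht
    have h1 := abs_real_inner_le_norm (w t) (w' t)
    have h2 := two_mul_norm_mul_norm_le_oscillatorEnergy (w := w) (w' := w') hμ t
    have h3 : oscillatorEnergy μ w w' t / √μ ≤ B' := by
      rw [hB']
      gcongr
      exact hup t ht
    have h4 : 0 ≤ ‖w t‖ * ‖w' t‖ := by positivity
    linarith
  have hw2 : ∀ t, a ≤ t → ‖w t‖ ^ 2 ≤ B / μ := by
    intro t ht
    rw [le_div_iff₀ hμ]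
    have := hup t ht
    unfold oscillatorEnergy at this
    nlinarith [sq_nonneg ‖w' t‖]
  set K2 := 2 * μ + |C| with hK2
  have hK20 : 0 < K2 := by positivity
  -- Chosen so that `K2 * ε = c / 2`, half of the lower energy bound. `M` then handles `‖w‖ ≥ √ε`,
  -- where the bounded quantity `‖w‖²` is at most a multiple of `‖w‖^p`, for any `p > 0`.
  set ε := c / (2 * K2) with hε
  have hε0 : 0 < ε := by positivity
  set M := B / μ / (√ε) ^ p with hM
  have hM0 : 0 < M := by positivity
  have hyoung : ∀ t, a ≤ t → ‖w t‖ ^ 2 ≤ ε + M * ‖w t‖ ^ p := by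
    intro t ht
    rcases le_total (‖w t‖) (√ε) with h1 | h1
    · have : ‖w t‖ ^ 2 ≤ ε := by
        rw [← Real.sq_sqrt hε0.le]
        gcongr
      have h2 : 0 ≤ M * ‖w t‖ ^ p := by positivity
      linarith
    · have h2 : B / μ ≤ M * ‖w t‖ ^ p := by
        rw [hM, div_mul_eq_mul_div, le_div_iff₀ (by positivity)]
        gcongr
      linarith [hw2 t ht]
  -- The derivative of `⟨w, w'⟩` is the energy minus `(2μ - C/t²)‖w‖²`. Half of the energy's lower
  -- bound `c` pays for the logarithm and the other half for `ε`; the term `B'/t` absorbs the error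
  -- `⟨w, w'⟩/t²`. So `g'` is dominated by an integrable function although `g` grows like `log`.
  set g : ℝ → ℝ := fun t => -(inner ℝ (w t) (w' t) / t) + c / 2 * Real.log t + B' / t with hg
  set g' : ℝ → ℝ := fun t => -((‖w' t‖ ^ 2 - (μ - C / t ^ 2) * ‖w t‖ ^ 2) / t -
    inner ℝ (w t) (w' t) / t ^ 2) + c / 2 / t - B' / t ^ 2 with hg'
  have hRt : ∀ t, a ≤ t → R < t := fun t ht => lt_of_lt_of_le hr (har.trans ht)
  have hderiv : ∀ t, a ≤ t → HasDerivAt g (g' t) t := by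
    intro t ht
    have ht0 : t ≠ 0 := by linarith
    have h1 := ((h.hasDerivAt t (hRt t ht)).inner ℝ (h.hasDerivAt' t (hRt t ht))).div
      (hasDerivAt_id t) ht0
    have h2 := (Real.hasDerivAt_log ht0).const_mul (c / 2)
    have h3 : HasDerivAt (fun t : ℝ => B' / t) (B' * -(t ^ 2)⁻¹) t := by
      simpa [div_eq_mul_inv] using (hasDerivAt_inv ht0).const_mul B'
    refine ((h1.neg.add h2).add h3).congr_deriv ?_
    simp only [hg', real_inner_smul_right, real_inner_self_eq_norm_sq, id]
    field_simp
    ring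
  have hle : ∀ t, a ≤ t → g' t ≤ K2 * M * (‖w t‖ ^ p / t) := by
    intro t ht
    have ht1 : 1 ≤ t := ha1.trans ht
    have ht0 : 0 < t := by linarith
    have e1 : g' t = (c / 2 - oscillatorEnergy μ w w' t + (2 * μ - C / t ^ 2) * ‖w t‖ ^ 2) / t +
        (inner ℝ (w t) (w' t) - B') / t ^ 2 := by
      simp only [hg', oscillatorEnergy]
      field_simp
      ring
    have e2 : (inner ℝ (w t) (w' t) - B') / t ^ 2 ≤ 0 :=
      div_nonpos_of_nonpos_of_nonneg (by linarith [(abs_le.1 (hww t ht)).2]) (by positivity)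
    have e3 : 2 * μ - C / t ^ 2 ≤ K2 := by
      have : -(C / t ^ 2) ≤ |C| := by
        refine (neg_le_abs _).trans ?_
        rw [abs_div, abs_of_nonneg (sq_nonneg t)]
        exact div_le_self (abs_nonneg _) (one_le_pow₀ ht1)
      linarith
    have e4 : (2 * μ - C / t ^ 2) * ‖w t‖ ^ 2 ≤ K2 * (ε + M * ‖w t‖ ^ p) := by
      have := hyoung t ht
      calc _ ≤ K2 * ‖w t‖ ^ 2 := by gcongr
        _ ≤ _ := by gcongr
    have e5 : K2 * ε = c / 2 := by
      rw [hε]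
      field_simp
    have e6 : c / 2 - oscillatorEnergy μ w w' t + (2 * μ - C / t ^ 2) * ‖w t‖ ^ 2 ≤
        K2 * M * ‖w t‖ ^ p := by
      have := hlow t ht
      nlinarith
    rw [e1, ← mul_div_assoc]
    have := div_le_div_of_nonneg_right e6 ht0.le
    linarith
  have hint : IntegrableOn (fun t => K2 * M * (‖w t‖ ^ p / t)) (Ioi a) :=
    (hb.mono_set (Ioi_subset_Ioi hab)).const_mul _
  set J := ∫ t in Ioi a, K2 * M * (‖w t‖ ^ p / t) with hJ
  have hbound : ∀ X, a ≤ X → c / 2 * Real.log X ≤ J + g a + B' := by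
    intro X hX
    have h1 : g X - g a ≤ ∫ t in a..X, K2 * M * (‖w t‖ ^ p / t) := by
      refine intervalIntegral.sub_le_integral_of_hasDeriv_right_of_le hX
        (fun t ht => (hderiv t ht.1).continuousAt.continuousWithinAt)
        (fun t ht => (hderiv t ht.1.le).hasDerivWithinAt) ?_ fun t ht => hle t ht.1.le
      rw [integrableOn_Icc_iff_integrableOn_Ioc]
      exact hint.mono_set Ioc_subset_Ioi_self
    have h2 : ∫ t in a..X, K2 * M * (‖w t‖ ^ p / t) ≤ J := by
      rw [intervalIntegral.integral_of_le hX]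
      refine setIntegral_mono_set hint ?_ (Eventually.of_forall Ioc_subset_Ioi_self)
      filter_upwards [ae_restrict_mem measurableSet_Ioi] with t ht
      have : 0 < t := by
        have := mem_Ioi.1 ht
        linarith
      simp only [Pi.zero_apply]
      positivity
    have hX0 : 0 < X := by linarith
    have h3 : inner ℝ (w X) (w' X) / X ≤ B' := by
      rw [div_le_iff₀ hX0]
      have := (abs_le.1 (hww X hX)).2
      have hB'0 : 0 < B' := by positivity
      nlinarith
    have h4 : 0 ≤ B' / X := by positivity
    have h5 : g X = -(inner ℝ (w X) (w' X) / X) + c / 2 * Real.log X + B' / X := rfl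
    linarith
  have htend : Tendsto (fun X => c / 2 * Real.log X) atTop atTop :=
    Real.tendsto_log_atTop.const_mul_atTop (by positivity)
  obtain ⟨X, hX1, hX2⟩ := ((htend.eventually_gt_atTop (J + g a + B')).and
    (eventually_ge_atTop a)).exists
  exact absurd (hbound X hX2) (not_le.2 hX1)

end IsPerturbedOscillator

/-- Liouville's substitution `w = r^((d-1)/2) u` in the radial Helmholtz equation. -/
theorem isPerturbedOscillator_of_radial {d c : ℝ} (hR : 0 ≤ R) {u u' u'' : ℝ → ℂ}
    (h1 : ∀ r, R < r → HasDerivAt u (u' r) r) (h2 : ∀ r, R < r → HasDerivAt u' (u'' r) r)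
    (h : ∀ r, R < r → (r : ℂ) ^ 2 * u'' r + (d - 1) * r * u' r + (μ * (r : ℂ) ^ 2 - c) * u r = 0) :
    IsPerturbedOscillator μ (c + (d - 1) / 2 * ((d - 1) / 2 - 1)) R
      (fun r => r ^ ((d - 1) / 2) • u r)
      (fun r => ((d - 1) / 2 * r ^ ((d - 1) / 2 - 1)) • u r + r ^ ((d - 1) / 2) • u' r) := by
  set a := (d - 1) / 2 with ha
  have hd : d = 2 * a + 1 := by
    rw [ha]
    ring
  have hpow : ∀ (a : ℝ) (r : ℝ), R < r → HasDerivAt (fun r : ℝ => r ^ a) (a * r ^ (a - 1)) r :=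
    fun a r hr => Real.hasDerivAt_rpow_const (Or.inl (by linarith))
  refine ⟨fun r hr => ?_, fun r hr => ?_⟩
  · refine ((hpow a r hr).smul (h1 r hr)).congr_deriv ?_
    rw [add_comm]
  · have hr0 : 0 < r := by linarith
    refine ((((hpow (a - 1) r hr).const_mul a).smul (h1 r hr)).add
      ((hpow a r hr).smul (h2 r hr))).congr_deriv ?_
    have e1 : r ^ (a - 1) = r ^ (a - 1 - 1) * r := by
      rw [← Real.rpow_add_one hr0.ne']
      ring_nf
    have e2 : r ^ a = r ^ (a - 1 - 1) * r ^ 2 := by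
      rw [← Real.rpow_add_natCast hr0.ne']
      congr 1
      push_cast
      ring
    have hrc : (r : ℂ) ≠ 0 := by exact_mod_cast hr0.ne'
    have hh := h r hr
    rw [hd] at hh
    simp only [Complex.real_smul, e2, e1]
    push_cast at hh ⊢
    field_simp
    linear_combination (↑(r ^ (a - 1 - 1)) : ℂ) * hh

end RadialEquation

/-! ### Density of polynomials on the sphere, polar coordinates, and vanishing for `p ≥ 1`. -/

section Sphere

variable {E : Type*} [NormedAddCommGroup E] [InnerProductSpace ℝ E]

open Metric Set

namespace IsSmoothHomogeneous

theorem one : IsSmoothHomogeneous 0 (fun _ : E => (1 : ℂ)) :=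
  ⟨contDiff_const, fun t _ x => by simp⟩

theorem inner_left (v : E) : IsSmoothHomogeneous 1 (fun x : E => ((inner ℝ v x : ℝ) : ℂ)) := by
  refine ⟨Complex.ofRealCLM.contDiff.comp (contDiff_const.inner ℝ contDiff_id), fun t _ x => ?_⟩
  simp [real_inner_smul_right]

theorem mul {k l : ℕ} {P Q : E → ℂ} (hP : IsSmoothHomogeneous k P) (hQ : IsSmoothHomogeneous l Q) :
    IsSmoothHomogeneous (k + l) (fun x => P x * Q x) := by
  refine ⟨hP.contDiff.mul hQ.contDiff, fun t ht x => ?_⟩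
  rw [hP.map_smul t ht, hQ.map_smul t ht]
  ring

end IsSmoothHomogeneous

variable [FiniteDimensional ℝ E] [MeasurableSpace E] [BorelSpace E]

/-- A continuous function on the unit sphere which is orthogonal to all homogeneous polynomials
vanishes. -/
theorem eq_zero_of_forall_isSmoothHomogeneous {g : sphere (0 : E) 1 → ℂ} (hg : Continuous g)
    (h : ∀ (k : ℕ) (Q : E → ℂ), IsSmoothHomogeneous k Q →
      ∫ ω, g ω * Q ω ∂(volume : Measure E).toSphere = 0) (ω : sphere (0 : E) 1) : g ω = 0 := by
  set σ := (volume : Measure E).toSphere with hσ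
  set coord : E → C(sphere (0 : E) 1, ℝ) := fun v => ⟨fun ω => inner ℝ v (ω : E), by fun_prop⟩
    with hcoord
  set A := Algebra.adjoin ℝ (range coord) with hA
  have hint : ∀ φ : C(sphere (0 : E) 1, ℝ), Integrable (fun ω => g ω * (φ ω : ℂ)) σ := fun φ =>
    Continuous.integrable_toSphere (by fun_prop)
  have hAzero : ∀ φ ∈ A, ∫ ω, g ω * (φ ω : ℂ) ∂σ = 0 := by
    intro φ hφ
    -- A polynomial need not be homogeneous, but the algebra is the linear span of products of
    -- linear functionals, and these are.
    rw [hA, ← Subalgebra.mem_toSubmodule, Algebra.adjoin_eq_span] at hφ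
    induction hφ using Submodule.span_induction with
    | mem φ hφ =>
      have : ∃ k Q, IsSmoothHomogeneous k Q ∧ ∀ ω : sphere (0 : E) 1, (φ ω : ℂ) = Q (ω : E) := by
        induction hφ using Submonoid.closure_induction with
        | mem φ hφ =>
          obtain ⟨v, rfl⟩ := hφ
          exact ⟨1, _, IsSmoothHomogeneous.inner_left v, fun ω => rfl⟩
        | one => exact ⟨0, _, IsSmoothHomogeneous.one, fun ω => by simp⟩
        | mul φ ψ _ _ h1 h2 =>
          obtain ⟨k, P, hP, hφP⟩ := h1
          obtain ⟨l, Q, hQ, hψQ⟩ := h2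
          exact ⟨_, _, hP.mul hQ, fun ω => by simp [hφP, hψQ]⟩
      obtain ⟨k, Q, hQ, hφQ⟩ := this
      simp only [hφQ]
      exact h k Q hQ
    | zero => simp
    | add φ ψ _ _ h1 h2 =>
      simp only [ContinuousMap.add_apply, Complex.ofReal_add, mul_add]
      rw [integral_add (hint φ) (hint ψ), h1, h2, add_zero]
    | smul c φ _ h1 =>
      simp only [ContinuousMap.smul_apply, smul_eq_mul, Complex.ofReal_mul,
        mul_left_comm _ (c : ℂ)]
      rw [integral_const_mul, h1, mul_zero]
  have hsep : A.SeparatesPoints := by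
    intro x y hxy
    refine ⟨coord (x - y : E), ⟨coord (x - y : E), Algebra.subset_adjoin ⟨_, rfl⟩, rfl⟩, ?_⟩
    intro heq
    apply hxy
    have h1 : inner ℝ ((x : E) - y) (x : E) = inner ℝ ((x : E) - y) (y : E) := heq
    rw [← sub_eq_zero, ← inner_sub_right, inner_self_eq_zero, sub_eq_zero] at h1
    exact Subtype.ext h1
  have hall : ∀ φ : C(sphere (0 : E) 1, ℝ), ∫ ω, g ω * (φ ω : ℂ) ∂σ = 0 := by
    intro φ
    rw [← norm_eq_zero]
    refine le_antisymm (le_of_forall_pos_le_add fun ε hε => ?_) (norm_nonneg _)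
    set N := ∫ ω, ‖g ω‖ ∂σ with hN
    have hN0 : 0 ≤ N := integral_nonneg fun ω => norm_nonneg _
    obtain ⟨a, ha⟩ := ContinuousMap.exists_mem_subalgebra_near_continuousMap_of_separatesPoints A
      hsep φ (ε / (N + 1)) (by positivity)
    have h1 : ∫ ω, g ω * (φ ω : ℂ) ∂σ =
        ∫ ω, g ω * (φ ω : ℂ) - g ω * ((a : C(sphere (0 : E) 1, ℝ)) ω : ℂ) ∂σ := by
      rw [integral_sub (hint φ) (hint a), hAzero a a.2, sub_zero]
    rw [h1, zero_add]
    calc _ ≤ ∫ ω, ‖g ω‖ * (ε / (N + 1)) ∂σ := by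
          refine norm_integral_le_of_norm_le (hg.norm.integrable_toSphere.mul_const _)
            (Filter.Eventually.of_forall fun ω => ?_)
          rw [← mul_sub, norm_mul, ← Complex.ofReal_sub, Complex.norm_real]
          gcongr
          have := ((a : C(sphere (0 : E) 1, ℝ)) - φ).norm_coe_le_norm ω
          rw [norm_sub_rev]
          exact this.trans ha.le
      _ = N / (N + 1) * ε := by
          rw [integral_mul_const]
          ring
      _ ≤ ε := mul_le_of_le_one_left hε.le ((div_le_one (by positivity)).2 (by linarith))
  -- Testing `g` against its own real and imaginary parts gives `∫ ‖g‖² = 0`, so the real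
  -- Stone-Weierstrass theorem suffices.
  have hre := hall ⟨fun ω => (g ω).re, by fun_prop⟩
  have him := hall ⟨fun ω => (g ω).im, by fun_prop⟩
  have hnorm : ∫ ω, ‖g ω‖ ^ 2 ∂σ = 0 := by
    have h1 : ∀ ω, ((‖g ω‖ ^ 2 : ℝ) : ℂ) = g ω * ((g ω).re : ℂ) - Complex.I *
        (g ω * ((g ω).im : ℂ)) := by
      intro ω
      push_cast
      rw [← Complex.mul_conj']
      have : starRingEnd ℂ (g ω) = (g ω).re - Complex.I * (g ω).im := by
        apply Complex.ext <;> simp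
      rw [this]
      ring
    rw [← Complex.ofReal_eq_zero, ← integral_complex_ofReal]
    simp only [h1]
    have i1 : Integrable (fun ω => g ω * ((g ω).re : ℂ)) σ :=
      Continuous.integrable_toSphere (by fun_prop)
    have i2 : Integrable (fun ω => g ω * ((g ω).im : ℂ)) σ :=
      Continuous.integrable_toSphere (by fun_prop)
    rw [integral_sub i1 (i2.const_mul _), integral_const_mul]
    simp only [ContinuousMap.coe_mk] at hre him
    rw [hre, him]
    simp
  rw [integral_eq_zero_iff_of_nonneg (fun ω => by positivity)
    (Continuous.integrable_toSphere (by fun_prop))] at hnorm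
  have hz := (Continuous.ae_eq_iff_eq σ (by fun_prop) continuous_zero).1 hnorm
  simpa using congrFun hz ω

/-- Integration in polar coordinates. -/
theorem lintegral_eq_lintegral_toSphere [Nontrivial E] {g : E → ℝ≥0∞} (hg : Measurable g) :
    ∫⁻ x, g x = ∫⁻ r in Ioi (0 : ℝ), ENNReal.ofReal (r ^ (Module.finrank ℝ E - 1)) *
      ∫⁻ ω : sphere (0 : E) 1, g (r • (ω : E)) ∂(volume : Measure E).toSphere := by
  set d := Module.finrank ℝ E
  have h1 : ∫⁻ x, g x = ∫⁻ x : ({(0 : E)}ᶜ : Set E), g x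
      ∂((volume : Measure E).comap Subtype.val) := by
    rw [lintegral_subtype_comap (measurableSet_singleton (0 : E)).compl, restrict_compl_singleton]
  have h2 := (volume : Measure E).measurePreserving_homeomorphUnitSphereProd.lintegral_comp_emb
    (homeomorphUnitSphereProd E).measurableEmbedding
    (fun z : sphere (0 : E) 1 × Ioi (0 : ℝ) => g ((z.2 : ℝ) • (z.1 : E)))
  have h3 : ∀ x : ({(0 : E)}ᶜ : Set E), ((homeomorphUnitSphereProd E x).2 : ℝ) •
      ((homeomorphUnitSphereProd E x).1 : E) = x := by
    intro x
    simp [smul_smul, mul_inv_cancel₀ (norm_ne_zero_iff.2 x.2)]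
  have hm : Measurable fun z : sphere (0 : E) 1 × Ioi (0 : ℝ) => g ((z.2 : ℝ) • (z.1 : E)) := by
    fun_prop
  have hm' : Measurable fun r : ℝ => ∫⁻ ω : sphere (0 : E) 1, g (r • (ω : E))
      ∂(volume : Measure E).toSphere :=
    Measurable.lintegral_prod_right' (f := fun z : ℝ × sphere (0 : E) 1 => g (z.1 • (z.2 : E)))
      (by fun_prop)
  simp only [h3] at h2
  rw [h1, h2, lintegral_prod_symm' _ hm, Measure.volumeIoiPow,
    lintegral_withDensity_eq_lintegral_mul _ (by fun_prop) (by fun_prop)]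
  exact lintegral_subtype_comap measurableSet_Ioi (fun r : ℝ => ENNReal.ofReal (r ^ (d - 1)) *
    ∫⁻ ω : sphere (0 : E) 1, g (r • (ω : E)) ∂(volume : Measure E).toSphere)

theorem setLIntegral_eq_lintegral_toSphere [Nontrivial E] {R : ℝ} (hR : 0 ≤ R) {g : E → ℝ≥0∞}
    (hg : Measurable g) :
    ∫⁻ x in {x | R < ‖x‖}, g x = ∫⁻ r in Ioi R, ENNReal.ofReal (r ^ (Module.finrank ℝ E - 1)) *
      ∫⁻ ω : sphere (0 : E) 1, g (r • (ω : E)) ∂(volume : Measure E).toSphere := by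
  have hs : MeasurableSet {x : E | R < ‖x‖} := measurableSet_lt measurable_const measurable_norm
  rw [← lintegral_indicator hs, lintegral_eq_lintegral_toSphere (hg.indicator hs),
    ← lintegral_indicator measurableSet_Ioi, ← lintegral_indicator measurableSet_Ioi]
  congr 1
  ext r
  by_cases hr0 : 0 < r
  · have hn : ∀ ω : sphere (0 : E) 1, ‖r • (ω : E)‖ = r := fun ω => by
      simp [norm_smul, abs_of_pos hr0]
    by_cases hr : R < r <;> simp [indicator, hr0, hr, hn]
  · have : ¬ R < r := fun h => hr0 (hR.trans_lt h)
    simp [indicator, hr0, this]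

/-- Hölder's inequality on the sphere, which has finite measure. It is essential that `K` does not
depend on `r`, so that the estimate can be integrated in `r`; this is also where `p ≥ 1` is needed.
-/
theorem enorm_sphericalMoment_rpow_le {p : ℝ} (hp : 1 ≤ p) {Q : E → ℂ} (hQ : Continuous Q) :
    ∃ K : ℝ≥0∞, K ≠ ∞ ∧ ∀ (f : E → ℂ) (r : ℝ),
      (Continuous fun ω : sphere (0 : E) 1 => f (r • (ω : E))) →
      ‖sphericalMoment f Q r‖ₑ ^ p ≤
        K * ∫⁻ ω : sphere (0 : E) 1, ‖f (r • (ω : E))‖ₑ ^ p ∂(volume : Measure E).toSphere := by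
  set σ := (volume : Measure E).toSphere with hσ
  obtain ⟨M, hM⟩ := (isCompact_sphere (0 : E) 1).exists_bound_of_continuousOn hQ.continuousOn
  have hp0 : 0 < p := by linarith
  refine ⟨ENNReal.ofReal M ^ p * (σ univ ^ (1 - 1 / p)) ^ p, ?_, fun f r hf => ?_⟩
  · refine ENNReal.mul_ne_top (ENNReal.rpow_ne_top_of_nonneg hp0.le ENNReal.ofReal_ne_top)
      (ENNReal.rpow_ne_top_of_nonneg hp0.le
        (ENNReal.rpow_ne_top_of_nonneg ?_ (measure_ne_top _ _)))
    rw [sub_nonneg, div_le_one hp0]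
    exact hp
  · have hc : Continuous fun ω : sphere (0 : E) 1 => f (r • (ω : E)) * Q ω :=
      hf.mul (hQ.comp continuous_subtype_val)
    have h1 := eLpNorm'_le_eLpNorm'_mul_rpow_measure_univ (μ := σ) one_pos hp
      hc.aestronglyMeasurable
    simp only [eLpNorm'_eq_lintegral_enorm, ENNReal.rpow_one, div_one] at h1
    have h2 : ∫⁻ ω : sphere (0 : E) 1, ‖f (r • (ω : E)) * Q ω‖ₑ ^ p ∂σ ≤
        ENNReal.ofReal M ^ p * ∫⁻ ω : sphere (0 : E) 1, ‖f (r • (ω : E))‖ₑ ^ p ∂σ := by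
      rw [← lintegral_const_mul' _ _
        (ENNReal.rpow_ne_top_of_nonneg hp0.le ENNReal.ofReal_ne_top)]
      refine lintegral_mono fun ω => ?_
      rw [enorm_mul, ENNReal.mul_rpow_of_nonneg _ _ hp0.le, mul_comm]
      gcongr
      rw [← ofReal_norm]
      exact ENNReal.ofReal_le_ofReal (hM ω ω.2)
    calc ‖sphericalMoment f Q r‖ₑ ^ p
        ≤ ((∫⁻ ω : sphere (0 : E) 1, ‖f (r • (ω : E)) * Q ω‖ₑ ^ p ∂σ) ^ (1 / p) *
          σ univ ^ (1 - 1 / p)) ^ p :=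
          ENNReal.rpow_le_rpow ((enorm_integral_le_lintegral_enorm _).trans h1) hp0.le
      _ = (∫⁻ ω : sphere (0 : E) 1, ‖f (r • (ω : E)) * Q ω‖ₑ ^ p ∂σ) *
          (σ univ ^ (1 - 1 / p)) ^ p := by
          rw [ENNReal.mul_rpow_of_nonneg _ _ hp0.le, ← ENNReal.rpow_mul,
            one_div_mul_cancel hp0.ne', ENNReal.rpow_one]
      _ ≤ (ENNReal.ofReal M ^ p * ∫⁻ ω : sphere (0 : E) 1, ‖f (r • (ω : E))‖ₑ ^ p ∂σ) *
          (σ univ ^ (1 - 1 / p)) ^ p := by gcongr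
      _ = _ := by ring

/-- Rellich's theorem for exponents `p ≥ 1`. -/
theorem eq_zero_of_setLIntegral_rpow_lt_top [Nontrivial E] {μ R R' p : ℝ} (hμ : 0 < μ)
    (hR : 0 ≤ R) {f : E → ℂ} (hf : ContDiffOn ℝ 2 f {x | R < ‖x‖})
    (hH : ∀ x ∈ {x : E | R < ‖x‖}, Laplacian.laplacian f x = -(μ : ℂ) * f x)
    (hp : 1 ≤ p) (hpd : ((Module.finrank ℝ E : ℝ) - 1) * p ≤ 2 * Module.finrank ℝ E)
    (hfin : ∫⁻ x in {x : E | R' < ‖x‖}, ‖f x‖ₑ ^ p < ∞) {x : E} (hx : R < ‖x‖) : f x = 0 := by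
  set d := Module.finrank ℝ E with hd
  have hd1 : 1 ≤ d := Module.finrank_pos
  have hp0 : 0 < p := by linarith
  set b := max (max R R') 1 with hb
  have hb1 : 1 ≤ b := le_max_right _ _
  have hbR : R ≤ b := (le_max_left _ _).trans (le_max_left _ _)
  have hbR' : R' ≤ b := (le_max_right _ _).trans (le_max_left _ _)
  have hU : IsOpen {x : E | R < ‖x‖} := isOpen_lt continuous_const continuous_norm
  have hrU : ∀ r ∈ Ioi R, ∀ ω : sphere (0 : E) 1, r • (ω : E) ∈ {x : E | R < ‖x‖} := by
    intro r hr ω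
    have hr' : R < r := hr
    simpa [norm_smul, abs_of_nonneg (hR.trans hr'.le)] using hr'
  have hfc : ∀ r, R < r → Continuous fun ω : sphere (0 : E) 1 => f (r • (ω : E)) := fun r hr =>
    hf.continuousOn.comp_continuous (by fun_prop) (hrU r hr)
  have hfinb : ∫⁻ r in Ioi b, ENNReal.ofReal (r ^ (d - 1)) *
      ∫⁻ ω : sphere (0 : E) 1, ‖f (r • (ω : E))‖ₑ ^ p ∂(volume : Measure E).toSphere < ∞ := by
    -- Nothing is known about `f` outside the domain, so polar coordinates are applied to its
    -- measurable extension by zero.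
    classical
    have hmeas : Measurable ({x : E | R < ‖x‖}.piecewise f 0) :=
      hf.continuousOn.measurable_piecewise continuous_zero.continuousOn hU.measurableSet
    have hpol := setLIntegral_eq_lintegral_toSphere (hR.trans hbR)
      (g := fun x => ‖{x : E | R < ‖x‖}.piecewise f 0 x‖ₑ ^ p) (by fun_prop)
    have e1 : ∫⁻ x in {x | b < ‖x‖}, ‖{x : E | R < ‖x‖}.piecewise f 0 x‖ₑ ^ p =
        ∫⁻ x in {x | b < ‖x‖}, ‖f x‖ₑ ^ p := by
      refine setLIntegral_congr_fun (measurableSet_lt measurable_const measurable_norm)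
        fun x hx => ?_
      have : x ∈ {x : E | R < ‖x‖} := lt_of_le_of_lt hbR hx
      simp only [piecewise_eq_of_mem _ _ _ this]
    have e2 : ∫⁻ r in Ioi b, ENNReal.ofReal (r ^ (d - 1)) *
        ∫⁻ ω : sphere (0 : E) 1, ‖{x : E | R < ‖x‖}.piecewise f 0 (r • (ω : E))‖ₑ ^ p
          ∂(volume : Measure E).toSphere = ∫⁻ r in Ioi b, ENNReal.ofReal (r ^ (d - 1)) *
        ∫⁻ ω : sphere (0 : E) 1, ‖f (r • (ω : E))‖ₑ ^ p ∂(volume : Measure E).toSphere := by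
      refine setLIntegral_congr_fun measurableSet_Ioi fun r hr => ?_
      have : ∀ ω : sphere (0 : E) 1, r • (ω : E) ∈ {x : E | R < ‖x‖} :=
        hrU r (lt_of_le_of_lt hbR hr)
      simp only [piecewise_eq_of_mem _ _ _ (this _)]
    rw [← e2, ← hpol, e1]
    refine lt_of_le_of_lt (lintegral_mono_set fun x hx => ?_) hfin
    exact lt_of_le_of_lt hbR' hx
  have hmom : ∀ (k : ℕ) (Q : E → ℂ), IsSmoothHomogeneous k Q → ∀ r, R < r →
      sphericalMoment f Q r = 0 := by
    intro k
    induction k using Nat.strong_induction_on with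
    | _ k ih =>
    intro Q hQ r hr
    -- The source term vanishes by induction, as `ΔQ` has degree `k - 2`, or is zero when `k < 2`.
    have hlap : ∀ r, R < r → sphericalMoment f (Laplacian.laplacian Q) r = 0 := by
      intro r hr
      rcases lt_or_ge k 2 with hk | hk
      · simp [sphericalMoment, hQ.laplacian_eq_zero hk]
      · obtain ⟨j, rfl⟩ := Nat.exists_eq_add_of_le' hk
        exact ih j (by omega) _ hQ.laplacian r hr
    have hQc := hQ.contDiff.continuous
    have h1 : ∀ r, R < r → HasDerivAt (sphericalMoment f Q) _ r := fun r hr =>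
      hasDerivAt_sphericalMoment hU isOpen_Ioi hrU (hf.of_le (by norm_num)) hQc hr
    have hosc := isPerturbedOscillator_of_radial (μ := μ) (d := d) (c := k * (k + d - 2)) hR h1
      (fun r hr => hasDerivAt_sphericalMoment_fderiv hU isOpen_Ioi hrU hf hQc hr) (fun r hr => by
        have := sphericalMoment_equation hU hf hH hQ (hR.trans_lt hr) (hrU r hr)
        rw [hlap r hr, neg_zero] at this
        push_cast
        exact this)
    obtain ⟨K, hK, hKf⟩ := enorm_sphericalMoment_rpow_le (E := E) hp hQc
    have hint : IntegrableOn (fun r : ℝ => ‖r ^ (((d : ℝ) - 1) / 2) • sphericalMoment f Q r‖ ^ p / r)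
        (Ioi b) := by
      constructor
      · refine ContinuousOn.aestronglyMeasurable (fun r hr => ?_) measurableSet_Ioi
        have hr' : b < r := hr
        refine ContinuousAt.continuousWithinAt ?_
        exact (((hosc.hasDerivAt r (hbR.trans_lt hr')).continuousAt.norm.rpow_const
          (Or.inr hp0.le)).div continuousAt_id (show r ≠ 0 by linarith))
      · refine lt_of_le_of_lt ?_ (ENNReal.mul_lt_top hK.lt_top hfinb)
        rw [← lintegral_const_mul' _ _ hK]
        refine setLIntegral_mono' measurableSet_Ioi fun r hr => ?_
        have hr' : b < r := hr
        have hr1 : 1 ≤ r := hb1.trans hr'.le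
        have hr0 : 0 < r := by linarith
        have e1 : ‖r ^ (((d : ℝ) - 1) / 2) • sphericalMoment f Q r‖ ^ p / r ≤
            r ^ (d - 1) * ‖sphericalMoment f Q r‖ ^ p := by
          rw [norm_smul, Real.norm_of_nonneg (by positivity), Real.mul_rpow (by positivity)
            (by positivity), ← Real.rpow_mul hr0.le, mul_div_right_comm]
          gcongr
          -- The critical exponent enters here: for `r ≥ 1`, the bound `r^((d-1)p/2) ≤ r^d` follows
          -- from `(d-1)p ≤ 2d`.
          rw [div_le_iff₀ hr0, ← pow_succ, Nat.sub_add_cancel hd1, ← Real.rpow_natCast]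
          refine Real.rpow_le_rpow_of_exponent_le hr1 ?_
          linarith
        calc ‖‖r ^ (((d : ℝ) - 1) / 2) • sphericalMoment f Q r‖ ^ p / r‖ₑ
            = ENNReal.ofReal (‖r ^ (((d : ℝ) - 1) / 2) • sphericalMoment f Q r‖ ^ p / r) := by
              rw [Real.enorm_of_nonneg (by positivity)]
          _ ≤ ENNReal.ofReal (r ^ (d - 1) * ‖sphericalMoment f Q r‖ ^ p) :=
              ENNReal.ofReal_le_ofReal e1
          _ = ENNReal.ofReal (r ^ (d - 1)) * ‖sphericalMoment f Q r‖ₑ ^ p := by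
              rw [ENNReal.ofReal_mul (by positivity), ← ENNReal.ofReal_rpow_of_nonneg
                (norm_nonneg _) hp0.le, ofReal_norm]
          _ ≤ ENNReal.ofReal (r ^ (d - 1)) * (K * ∫⁻ ω : sphere (0 : E) 1,
              ‖f (r • (ω : E))‖ₑ ^ p ∂(volume : Measure E).toSphere) := by
              gcongr
              exact hKf f r (hfc r (hbR.trans_lt hr'))
          _ = _ := by ring
    have := hosc.eq_zero_of_integrableOn hμ hR hp0 hint hr
    have hr0 : 0 < r := hR.trans_lt hr
    simpa [(Real.rpow_pos_of_pos hr0 _).ne'] using this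
  have hx0 : 0 < ‖x‖ := hR.trans_lt hx
  have := eq_zero_of_forall_isSmoothHomogeneous (hfc _ hx) (fun k Q hQ => hmom k Q hQ _ hx)
    ⟨‖x‖⁻¹ • x, by simp [norm_smul, hx0.ne']⟩
  simpa [smul_smul, hx0.ne'] using this

end Sphere

/-! ### Mean value inequality and the reduction of small exponents to `p = 1`. -/

section MeanValue

open Metric Set

/-- A solution of the radial Helmholtz equation which is regular at the origin stays close to its
value at the origin. -/
theorem norm_le_two_mul_norm_of_radial {μ ρ : ℝ} {e : ℕ} (hμ : 0 ≤ μ) (hρ : μ * ρ ^ 2 ≤ 1 / 4)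
    {u u' u'' : ℝ → ℂ} (h1 : ∀ r ∈ Ico 0 ρ, HasDerivAt u (u' r) r)
    (h2 : ∀ r ∈ Ico 0 ρ, HasDerivAt u' (u'' r) r) (h0 : u' 0 = 0)
    (h : ∀ r ∈ Ioo 0 ρ, (r : ℂ) ^ 2 * u'' r + (e + 1) * r * u' r + μ * (r : ℂ) ^ 2 * u r = 0)
    {r : ℝ} (hr : r ∈ Ico 0 ρ) : ‖u 0‖ ≤ 2 * ‖u r‖ := by
  have hmem : ∀ s ∈ Icc 0 r, s ∈ Ico 0 ρ := fun s hs => ⟨hs.1, hs.2.trans_lt hr.2⟩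
  obtain ⟨s₀, hs₀, hmax⟩ := isCompact_Icc.exists_isMaxOn (nonempty_Icc.2 hr.1)
    (f := fun s => ‖u s‖) fun s hs => (h1 s (hmem s hs)).continuousAt.norm.continuousWithinAt
  set M := ‖u s₀‖ with hM
  have hM0 : 0 ≤ M := norm_nonneg _
  have hle : ∀ s ∈ Icc 0 r, ‖u s‖ ≤ M := fun s hs => hmax hs
  -- The divergence form of the equation. Integrating it from the origin, where the flux is zero,
  -- bounds `u'` by the maximum `M` of `‖u‖`.
  have hφ : ∀ s ∈ Icc 0 r, HasDerivAt (fun t : ℝ => (t : ℂ) ^ (e + 1) * u' t)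
      (-(μ * (s : ℂ) ^ (e + 1) * u s)) s := by
    intro s hs
    have hd := (((hasDerivAt_id s).ofReal_comp.pow (e + 1)).mul (h2 s (hmem s hs)))
    refine hd.congr_deriv ?_
    rcases hs.1.eq_or_lt with rfl | hs0
    · simp [h0]
    · have hs0' : (s : ℂ) ≠ 0 := by exact_mod_cast hs0.ne'
      have := h s ⟨hs0, (hmem s hs).2⟩
      apply mul_left_cancel₀ hs0'
      simp only [id, Nat.add_sub_cancel, Pi.pow_apply, pow_succ] at this ⊢
      push_cast
      linear_combination (s : ℂ) ^ e * this
  have hu' : ∀ s ∈ Icc 0 r, ‖u' s‖ ≤ μ * r * M := by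
    intro s hs
    rcases hs.1.eq_or_lt with rfl | hs0
    · rw [h0, norm_zero]
      exact mul_nonneg (mul_nonneg hμ hr.1) hM0
    have hsub : ∀ t ∈ Icc 0 s, t ∈ Icc 0 r := fun t ht => ⟨ht.1, ht.2.trans hs.2⟩
    have := norm_image_sub_le_of_norm_deriv_le_segment'
      (f := fun t : ℝ => (t : ℂ) ^ (e + 1) * u' t) (C := μ * s ^ (e + 1) * M)
      (fun t ht => (hφ t (hsub t ht)).hasDerivWithinAt) (fun t ht => ?_) s ⟨hs0.le, le_rfl⟩
    · simp only [Complex.ofReal_zero, ne_eq, Nat.add_eq_zero_iff, one_ne_zero, and_false,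
        not_false_eq_true, zero_pow, zero_mul, sub_zero, norm_mul, norm_pow, Complex.norm_real,
        Real.norm_of_nonneg hs0.le] at this
      have hsp : 0 < s ^ (e + 1) := by positivity
      have h3 : ‖u' s‖ ≤ μ * s * M := by
        refine le_of_mul_le_mul_left ?_ hsp
        linarith
      refine h3.trans ?_
      gcongr
      exact hs.2
    · have ht' := hsub t ⟨ht.1, ht.2.le⟩
      rw [norm_neg, norm_mul, norm_mul, norm_pow, Complex.norm_real, Complex.norm_real,
        Real.norm_of_nonneg hμ, Real.norm_of_nonneg ht.1]
      have := hle t ht'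
      have := ht.1
      gcongr
      exact ht.2.le
  have hu : ∀ s ∈ Icc 0 r, ‖u s - u 0‖ ≤ M / 4 := by
    intro s hs
    have := norm_image_sub_le_of_norm_deriv_le_segment'
      (fun t ht => (h1 t (hmem t ht)).hasDerivWithinAt)
      (fun t ht => hu' t ⟨ht.1, ht.2.le⟩) s hs
    refine this.trans ?_
    have hr2 : r ^ 2 ≤ ρ ^ 2 := pow_le_pow_left₀ hr.1 hr.2.le 2
    calc μ * r * M * (s - 0) ≤ μ * r * M * r := by
          have := hr.1
          gcongr
          linarith [hs.2]
      _ = μ * r ^ 2 * M := by ring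
      _ ≤ μ * ρ ^ 2 * M := by gcongr
      _ ≤ 1 / 4 * M := by gcongr
      _ = M / 4 := by ring
  -- At the maximum point, `M ≤ ‖u 0‖ + M/4`, so `M ≤ 4/3 ‖u 0‖`; at `r` this gives `‖u 0‖ ≤ ‖u r‖ +
  -- ‖u 0‖/3`. The resulting constant `3/2` is relaxed to `2`.
  have e1 := hu s₀ hs₀
  have e2 := hu r ⟨hr.1, le_rfl⟩
  have e3 := norm_sub_norm_le (u s₀) (u 0)
  have e4 := norm_sub_norm_le (u 0) (u r)
  rw [norm_sub_rev] at e4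
  linarith

variable {E : Type*} [NormedAddCommGroup E] [InnerProductSpace ℝ E] [FiniteDimensional ℝ E]
  [MeasurableSpace E] [BorelSpace E]

/-- Antipodal symmetry. Applied to the differential of `f` at the centre, it shows that the
spherical mean has zero derivative at radius `0`. -/
theorem integral_toSphere_continuousLinearMap (l : E →L[ℝ] ℂ) :
    ∫ ω : sphere (0 : E) 1, l ω ∂(volume : Measure E).toSphere = 0 := by
  have h := integral_toSphere_comp_linearIsometryEquiv (LinearIsometryEquiv.neg ℝ) (g := l)
  simp only [LinearIsometryEquiv.coe_neg, map_neg, integral_neg] at h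
  exact self_eq_neg.1 h.symm

theorem lintegral_ball_mono_of_sphere [Nontrivial E] {ρ : ℝ} {g h : E → ℝ≥0∞}
    (hg : Measurable g) (hh : Measurable h)
    (hgh : ∀ r ∈ Ioo 0 ρ, ∫⁻ ω : sphere (0 : E) 1, g (r • (ω : E)) ∂(volume : Measure E).toSphere ≤
      ∫⁻ ω : sphere (0 : E) 1, h (r • (ω : E)) ∂(volume : Measure E).toSphere) :
    ∫⁻ x in ball (0 : E) ρ, g x ≤ ∫⁻ x in ball (0 : E) ρ, h x := by
  rw [← lintegral_indicator measurableSet_ball, ← lintegral_indicator measurableSet_ball,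
    lintegral_eq_lintegral_toSphere (hg.indicator measurableSet_ball),
    lintegral_eq_lintegral_toSphere (hh.indicator measurableSet_ball)]
  refine setLIntegral_mono' measurableSet_Ioi fun r hr => ?_
  have hr0 : 0 < r := hr
  have hn : ∀ ω : sphere (0 : E) 1, ‖r • (ω : E)‖ = r := fun ω => by
    simp [norm_smul, abs_of_pos hr0]
  gcongr 1
  by_cases hrρ : r < ρ
  · simpa [indicator, hn, hrρ] using hgh r ⟨hr0, hrρ⟩
  · simp [indicator, hn, hrρ]

/-- Mean value inequality for the Helmholtz equation, at the origin. -/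
theorem enorm_zero_mul_volume_ball_le (hd : 2 ≤ Module.finrank ℝ E) {μ ρ : ℝ} (hμ : 0 ≤ μ)
    (hρ0 : 0 < ρ) (hρ : μ * ρ ^ 2 ≤ 1 / 4) {f : E → ℂ} (hf : ContDiffOn ℝ 2 f (ball 0 ρ))
    (hH : ∀ x ∈ ball (0 : E) ρ, Laplacian.laplacian f x = -(μ : ℂ) * f x) :
    ‖f 0‖ₑ * volume (ball (0 : E) ρ) ≤ 2 * ∫⁻ x in ball (0 : E) ρ, ‖f x‖ₑ := by
  classical
  have : Nontrivial E := Module.nontrivial_of_finrank_pos (R := ℝ) (by omega)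
  obtain ⟨e, he⟩ := Nat.exists_eq_add_of_le' hd
  set σ := (volume : Measure E).toSphere with hσ
  have hmemball : ∀ r ∈ Ioo (-ρ) ρ, ∀ ω : sphere (0 : E) 1, r • (ω : E) ∈ ball (0 : E) ρ := by
    intro r hr ω
    simpa [norm_smul] using abs_lt.2 hr
  have hsub : ∀ r ∈ Ico 0 ρ, r ∈ Ioo (-ρ) ρ := fun r hr => ⟨by linarith [hr.1], hr.2⟩
  have hone := IsSmoothHomogeneous.one (E := E)
  have key : ∀ r ∈ Ioo 0 ρ, ‖f 0‖ₑ * σ univ ≤ 2 * ∫⁻ ω : sphere (0 : E) 1, ‖f (r • (ω : E))‖ₑ ∂σ := by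
    intro r hr
    have h := norm_le_two_mul_norm_of_radial (e := e) hμ hρ
      (fun r hr => hasDerivAt_sphericalMoment isOpen_ball isOpen_Ioo hmemball
        (hf.of_le (by norm_num)) hone.contDiff.continuous (hsub r hr))
      (fun r hr => hasDerivAt_sphericalMoment_fderiv isOpen_ball isOpen_Ioo hmemball hf
        hone.contDiff.continuous (hsub r hr))
      (by simpa using integral_toSphere_continuousLinearMap (fderiv ℝ f 0))
      (fun r hr => by
        have h3 := sphericalMoment_equation isOpen_ball hf hH hone hr.1
          (hmemball r (hsub r ⟨hr.1.le, hr.2⟩))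
        have h4 : sphericalMoment f (Laplacian.laplacian fun _ : E => (1 : ℂ)) r = 0 := by
          simp [sphericalMoment, hone.laplacian_eq_zero (by norm_num)]
        rw [h4, he] at h3
        push_cast at h3
        linear_combination h3) ⟨hr.1.le, hr.2⟩
    have h5 : sphericalMoment f (fun _ : E => (1 : ℂ)) 0 = σ.real univ * f 0 := by
      simp [sphericalMoment, hσ]
    rw [h5] at h
    have h6 : ‖(σ.real univ : ℂ) * f 0‖ₑ ≤ 2 * ‖sphericalMoment f (fun _ : E => (1 : ℂ)) r‖ₑ := by
      rw [← ofReal_norm, ← ofReal_norm, show (2 : ℝ≥0∞) = ENNReal.ofReal 2 by simp,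
        ← ENNReal.ofReal_mul (by norm_num)]
      exact ENNReal.ofReal_le_ofReal h
    have h7 : ‖(σ.real univ : ℂ)‖ₑ = σ univ := by
      rw [← ofReal_norm, Complex.norm_real, Real.norm_of_nonneg measureReal_nonneg]
      simp [Measure.real]
    rw [enorm_mul, h7, mul_comm] at h6
    refine h6.trans ?_
    gcongr
    refine (enorm_integral_le_lintegral_enorm _).trans (le_of_eq ?_)
    simp [hσ]
  set F := (ball (0 : E) ρ).piecewise f 0 with hF
  have hFm : Measurable F :=
    hf.continuousOn.measurable_piecewise continuous_zero.continuousOn measurableSet_ball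
  have hmono := lintegral_ball_mono_of_sphere (E := E) (ρ := ρ) (g := fun _ => ‖f 0‖ₑ)
    (h := fun x => 2 * ‖F x‖ₑ) measurable_const (by fun_prop) fun r hr => by
      have : ∀ ω : sphere (0 : E) 1, F (r • (ω : E)) = f (r • (ω : E)) := fun ω =>
        piecewise_eq_of_mem _ _ _ (hmemball r (hsub r ⟨hr.1.le, hr.2⟩) ω)
      simp only [this]
      rw [lintegral_const, lintegral_const_mul' _ _ (by simp)]
      exact key r hr
  rw [setLIntegral_const, lintegral_const_mul' _ _ (by simp)] at hmono
  refine hmono.trans (le_of_eq ?_)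
  congr 1
  refine setLIntegral_congr_fun measurableSet_ball fun x hx => ?_
  simp only [hF, piecewise_eq_of_mem _ _ _ hx]

/-- Mean value inequality for the Helmholtz equation. -/
theorem enorm_mul_volume_ball_le (hd : 2 ≤ Module.finrank ℝ E) {μ ρ : ℝ} (hμ : 0 ≤ μ)
    (hρ0 : 0 < ρ) (hρ : μ * ρ ^ 2 ≤ 1 / 4) {f : E → ℂ} {x : E} (hf : ContDiffOn ℝ 2 f (ball x ρ))
    (hH : ∀ y ∈ ball x ρ, Laplacian.laplacian f y = -(μ : ℂ) * f y) :
    ‖f x‖ₑ * volume (ball x ρ) ≤ 2 * ∫⁻ y in ball x ρ, ‖f y‖ₑ := by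
  have hpre : (fun y => x + y) ⁻¹' ball x ρ = ball 0 ρ := by
    ext y
    simp [dist_eq_norm]
  have h := enorm_zero_mul_volume_ball_le hd hμ hρ0 hρ (f := fun y => f (x + y))
    (hf.comp (by fun_prop) fun y hy => by rwa [← hpre] at hy) (fun y hy => by
      have hy' : x + y ∈ ball x ρ := by rwa [← hpre] at hy
      rw [← hH _ hy', laplacian_eq_sum_fderiv_fderiv (stdOrthonormalBasis ℝ E),
        laplacian_eq_sum_fderiv_fderiv (stdOrthonormalBasis ℝ E)]
      have : fderiv ℝ (fun y => f (x + y)) = fun y => fderiv ℝ f (x + y) := by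
        ext1 y
        exact fderiv_comp_add_left x
      rw [this, fderiv_comp_add_left])
  have hvol : volume (ball (0 : E) ρ) = volume (ball x ρ) := by
    rw [← hpre, measure_preimage_add]
  have hint : ∫⁻ y in ball (0 : E) ρ, ‖f (x + y)‖ₑ = ∫⁻ y in ball x ρ, ‖f y‖ₑ := by
    rw [← hpre]
    exact (measurePreserving_add_left volume x).setLIntegral_comp_preimage_emb
      (measurableEmbedding_addLeft x) (fun y => ‖f y‖ₑ) _
  rwa [add_zero, hvol, hint] at h

/-- The mean value inequality self-improves to exponents `p ≤ 1`. -/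
theorem norm_rpow_le_of_mean_value_inequality [Nontrivial E] {f : E → ℂ} {x : E} {δ p : ℝ}
    (hδ : 0 < δ)
    (hp : 0 < p) (hp1 : p ≤ 1) (hf : ContinuousOn f (closedBall x δ))
    (hmean : ∀ y ρ, 0 < ρ → ρ ≤ δ → ball y ρ ⊆ ball x δ →
      ‖f y‖ₑ * volume (ball y ρ) ≤ 2 * ∫⁻ z in ball y ρ, ‖f z‖ₑ)
    {A : ℝ} (hA0 : 0 ≤ A) (hA : ∫⁻ z in ball x δ, ‖f z‖ₑ ^ p ≤ ENNReal.ofReal A) :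
    ‖f x‖ ^ p ≤ 2 * 2 ^ ((Module.finrank ℝ E : ℝ) / p) /
      volume.real (ball (0 : E) 1) / δ ^ Module.finrank ℝ E * A := by
  set d := Module.finrank ℝ E with hd
  set a : ℝ := d / p with ha
  have ha0 : 0 ≤ a := by positivity
  set V := volume.real (ball (0 : E) 1) with hV
  have hV0 : 0 < V := ENNReal.toReal_pos (measure_ball_pos _ _ one_pos).ne'
    measure_ball_lt_top.ne
  -- Let `y` maximize `‖f‖` weighted by a power of the distance `s` to the boundary. On the ball of
  -- radius `s/2` around `y` the weight drops by at most `2^a`, so `‖f‖ ≤ 2^a ‖f y‖` there, and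
  -- `‖f‖^(1-p)` can be taken out of the mean value integral. The exponent `a = d/p` makes the
  -- `p`-th power of the weight scale like volume.
  obtain ⟨y, hy, hmax⟩ := (isCompact_closedBall x δ).exists_isMaxOn
    ⟨x, mem_closedBall_self hδ.le⟩ (f := fun y => (δ - dist y x) ^ a * ‖f y‖)
    (ContinuousOn.mul (Continuous.continuousOn
      (Continuous.rpow_const (by fun_prop) fun _ => Or.inr ha0)) hf.norm)
  have hx : δ ^ a * ‖f x‖ ≤ (δ - dist y x) ^ a * ‖f y‖ := by
    simpa using hmax (mem_closedBall_self hδ.le)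
  rcases eq_or_ne (f x) 0 with hfx | hfx
  · rw [hfx, norm_zero, Real.zero_rpow hp.ne']
    positivity
  have hfx0 : 0 < ‖f x‖ := norm_pos_iff.2 hfx
  have hpos : 0 < (δ - dist y x) ^ a * ‖f y‖ := lt_of_lt_of_le (by positivity) hx
  have hfy0 : 0 < ‖f y‖ := by
    refine lt_of_le_of_ne (norm_nonneg _) fun h => ?_
    rw [← h, mul_zero] at hpos
    exact lt_irrefl _ hpos
  have ha_pos : 0 < a := by
    have : 0 < (d : ℝ) := by exact_mod_cast (Module.finrank_pos (R := ℝ) (M := E))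
    positivity
  set s := δ - dist y x with hs
  have hs0 : 0 < s := by
    have h1 : 0 ≤ s := sub_nonneg.2 hy
    refine lt_of_le_of_ne h1 fun h => ?_
    rw [← h, Real.zero_rpow ha_pos.ne', zero_mul] at hpos
    exact lt_irrefl _ hpos
  have hsubset : ball y (s / 2) ⊆ ball x δ := ball_subset_ball' (by linarith)
  have hz : ∀ z ∈ ball y (s / 2), ‖f z‖ ≤ 2 ^ a * ‖f y‖ := by
    intro z hz
    have h1 : (δ - dist z x) ^ a * ‖f z‖ ≤ s ^ a * ‖f y‖ :=
      hmax (ball_subset_closedBall (hsubset hz))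
    have h2 : s / 2 ≤ δ - dist z x := by
      have := dist_triangle z y x
      have := mem_ball.1 hz
      linarith
    have h3 : (s / 2) ^ a * ‖f z‖ ≤ s ^ a * ‖f y‖ := by
      refine le_trans ?_ h1
      gcongr
    rw [Real.div_rpow hs0.le (by norm_num), div_mul_eq_mul_div, div_le_iff₀ (by positivity)] at h3
    have hsa : 0 < s ^ a := by positivity
    refine le_of_mul_le_mul_left ?_ hsa
    linarith
  set T := (2 ^ a * ‖f y‖) ^ (1 - p) with hT
  have hT0 : 0 ≤ T := by positivity
  have hint : ∫⁻ z in ball y (s / 2), ‖f z‖ₑ ≤ ENNReal.ofReal T * ENNReal.ofReal A := by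
    calc ∫⁻ z in ball y (s / 2), ‖f z‖ₑ
        ≤ ∫⁻ z in ball y (s / 2), ENNReal.ofReal T * ‖f z‖ₑ ^ p := by
          refine setLIntegral_mono' measurableSet_ball fun z hzm => ?_
          rw [← ofReal_norm, ENNReal.ofReal_rpow_of_nonneg (norm_nonneg _) hp.le,
            ← ENNReal.ofReal_mul hT0]
          refine ENNReal.ofReal_le_ofReal ?_
          calc ‖f z‖ = ‖f z‖ ^ (1 - p) * ‖f z‖ ^ p := by
                rw [← Real.rpow_add_of_nonneg (norm_nonneg _) (by linarith) hp.le]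
                simp
            _ ≤ T * ‖f z‖ ^ p := by
                gcongr
                exact Real.rpow_le_rpow (norm_nonneg _) (hz z hzm) (by linarith)
      _ = ENNReal.ofReal T * ∫⁻ z in ball y (s / 2), ‖f z‖ₑ ^ p :=
          lintegral_const_mul' _ _ ENNReal.ofReal_ne_top
      _ ≤ _ := by
          gcongr
          exact (lintegral_mono_set hsubset).trans hA
  have hmy := (hmean y (s / 2) (by positivity) (by linarith [dist_nonneg (x := y) (y := x)]) hsubset).trans (mul_le_mul_right hint 2)
  have hvol : volume (ball y (s / 2)) = ENNReal.ofReal ((s / 2) ^ d * V) := by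
    rw [Measure.addHaar_ball_of_pos _ _ (by positivity), ENNReal.ofReal_mul (by positivity), hV,
      ofReal_measureReal measure_ball_lt_top.ne]
  rw [hvol, ← ofReal_norm, ← ENNReal.ofReal_mul (norm_nonneg _), ← ENNReal.ofReal_mul hT0,
    show (2 : ℝ≥0∞) = ENNReal.ofReal 2 by simp, ← ENNReal.ofReal_mul (by norm_num),
    ENNReal.ofReal_le_ofReal_iff (by positivity)] at hmy
  have hTeq : T = 2 ^ (a - d) * (‖f y‖ / ‖f y‖ ^ p) := by
    rw [hT, Real.mul_rpow (by positivity) (by positivity), ← Real.rpow_mul (by norm_num),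
      Real.rpow_sub hfy0, Real.rpow_one]
    congr 2
    rw [ha]
    field_simp
  have hpa : ∀ t : ℝ, 0 < t → (t ^ a) ^ p = t ^ d := by
    intro t ht
    rw [← Real.rpow_mul ht.le, ha, div_mul_cancel₀ _ hp.ne', Real.rpow_natCast]
  have hN : δ ^ d * ‖f x‖ ^ p ≤ s ^ d * ‖f y‖ ^ p := by
    have := Real.rpow_le_rpow (by positivity) hx hp.le
    rwa [Real.mul_rpow (by positivity) (by positivity), Real.mul_rpow (by positivity)
      (by positivity), hpa δ hδ, hpa s hs0] at this
  have hfyp : 0 < ‖f y‖ ^ p := by positivity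
  have h2a : (2 : ℝ) ^ (a - d) = 2 ^ a / 2 ^ d := by
    rw [Real.rpow_sub (by norm_num), Real.rpow_natCast]
  have hfin : s ^ d * ‖f y‖ ^ p * V ≤ 2 * 2 ^ a * A := by
    rw [hTeq, h2a, div_pow] at hmy
    have h3 : ‖f y‖ * (s ^ d / 2 ^ d * V) = ‖f y‖ / (2 ^ d * ‖f y‖ ^ p) *
      (s ^ d * ‖f y‖ ^ p * V) := by field_simp
    have h4 : 2 * (2 ^ a / 2 ^ d * (‖f y‖ / ‖f y‖ ^ p) * A) = ‖f y‖ / (2 ^ d * ‖f y‖ ^ p) *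
      (2 * 2 ^ a * A) := by field_simp
    rw [h3, h4] at hmy
    exact le_of_mul_le_mul_left hmy (by positivity)
  rw [div_div, div_mul_eq_mul_div, le_div_iff₀ (by positivity)]
  nlinarith

/-- Integrability to a power `p ≤ 1` near infinity improves to integrability. -/
theorem exists_setLIntegral_enorm_lt_top (hd : 2 ≤ Module.finrank ℝ E) {μ R p : ℝ} (hμ : 0 < μ)
    {f : E → ℂ} (hf : ContDiffOn ℝ 2 f {x | R < ‖x‖})
    (hH : ∀ x ∈ {x : E | R < ‖x‖}, Laplacian.laplacian f x = -(μ : ℂ) * f x)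
    (hp : 0 < p) (hp1 : p ≤ 1) (hfin : ∫⁻ x in {x : E | R < ‖x‖}, ‖f x‖ₑ ^ p < ∞) :
    ∃ R', ∫⁻ x in {x : E | R' < ‖x‖}, ‖f x‖ₑ < ∞ := by
  have : Nontrivial E := Module.nontrivial_of_finrank_pos (R := ℝ) (by omega)
  -- The largest radius with `μ δ² ≤ 1/4`, as the mean value inequality requires. A radius
  -- independent of the centre gives a uniform bound for `f` near infinity.
  set δ : ℝ := 1 / (2 * √μ) with hδ
  have hsμ : 0 < √μ := Real.sqrt_pos.2 hμ
  have hδ0 : 0 < δ := by positivity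
  have hμδ : μ * δ ^ 2 = 1 / 4 := by
    rw [hδ, div_pow, mul_pow, Real.sq_sqrt hμ.le]
    field_simp
    norm_num
  set A := ∫⁻ x in {x : E | R < ‖x‖}, ‖f x‖ₑ ^ p with hA
  have hball : ∀ x : E, R + δ < ‖x‖ → closedBall x δ ⊆ {x : E | R < ‖x‖} := by
    intro x hx y hy
    have h1 : ‖x - y‖ ≤ δ := by
      rw [← dist_eq_norm, dist_comm]
      exact hy
    have h2 := norm_sub_norm_le x y
    show R < ‖y‖
    linarith
  obtain ⟨B, hB0, hB⟩ : ∃ B : ℝ, 0 ≤ B ∧ ∀ x : E, R + δ < ‖x‖ → ‖f x‖ ^ p ≤ B := by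
    refine ⟨_, ?_, fun x hx => norm_rpow_le_of_mean_value_inequality (A := A.toReal) hδ0 hp hp1
      (hf.continuousOn.mono (hball x hx)) (fun y ρ hρ hρδ hsub => ?_) ENNReal.toReal_nonneg ?_⟩
    · positivity
    · have hsub' : ball y ρ ⊆ {x : E | R < ‖x‖} :=
        hsub.trans (ball_subset_closedBall.trans (hball x hx))
      refine enorm_mul_volume_ball_le hd hμ.le hρ ?_ (hf.mono hsub') fun z hz => hH z (hsub' hz)
      rw [← hμδ]
      gcongr
    · rw [ENNReal.ofReal_toReal hfin.ne]
      exact lintegral_mono_set (ball_subset_closedBall.trans (hball x hx))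
  have hB' : ∀ x : E, R + δ < ‖x‖ → ‖f x‖ ≤ B ^ (1 / p) := by
    intro x hx
    have := Real.rpow_le_rpow (by positivity) (hB x hx) (by positivity : 0 ≤ 1 / p)
    rwa [← Real.rpow_mul (norm_nonneg _), mul_one_div_cancel hp.ne', Real.rpow_one] at this
  set T := (B ^ (1 / p)) ^ (1 - p) with hT
  have hT0 : 0 ≤ T := by positivity
  refine ⟨R + δ, ?_⟩
  refine lt_of_le_of_lt ?_ (ENNReal.mul_lt_top (ENNReal.ofReal_lt_top (r := T)) hfin)
  rw [hA, ← lintegral_const_mul' _ _ ENNReal.ofReal_ne_top]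
  calc ∫⁻ x in {x : E | R + δ < ‖x‖}, ‖f x‖ₑ
      ≤ ∫⁻ x in {x : E | R + δ < ‖x‖}, ENNReal.ofReal T * ‖f x‖ₑ ^ p := by
        refine setLIntegral_mono' (measurableSet_lt measurable_const measurable_norm)
          fun x hx => ?_
        rw [← ofReal_norm, ENNReal.ofReal_rpow_of_nonneg (norm_nonneg _) hp.le,
          ← ENNReal.ofReal_mul hT0]
        refine ENNReal.ofReal_le_ofReal ?_
        calc ‖f x‖ = ‖f x‖ ^ (1 - p) * ‖f x‖ ^ p := by
              rw [← Real.rpow_add_of_nonneg (norm_nonneg _) (by linarith) hp.le]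
              simp
          _ ≤ T * ‖f x‖ ^ p := by
              gcongr
              exact Real.rpow_le_rpow (norm_nonneg _) (hB' x hx) (by linarith)
    _ ≤ _ := lintegral_mono_set fun x hx => by
        have : R + δ < ‖x‖ := hx
        show R < ‖x‖
        linarith

end MeanValue

/-! ### The entire Bessel series and its recurrences. -/

section Series

open Filter

/-- The coefficients of `besselSeries`. -/
noncomputable def besselCoeff (μ q : ℝ) (k : ℕ) : ℝ :=
  (-μ / 4) ^ k / ((k.factorial : ℝ) * Real.Gamma (k + q))

/-- The entire function `∑ (-μ/4)^k / (k! Γ(k + q)) s^k`. -/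
noncomputable def besselSeries (μ q s : ℝ) : ℝ := ∑' k : ℕ, besselCoeff μ q k * s ^ k

variable {μ q : ℝ}

theorem besselCoeff_succ_mul (k : ℕ) :
    besselCoeff μ q (k + 1) * (k + 1) = -μ / 4 * besselCoeff μ (q + 1) k := by
  unfold besselCoeff
  have h : ((k + 1 : ℕ) : ℝ) + q = k + (q + 1) := by
    push_cast
    ring
  rw [h, Nat.factorial_succ]
  push_cast
  have : (k : ℝ) + 1 ≠ 0 := by positivity
  field_simp
  ring

theorem besselCoeff_eq_mul (hq : 0 < q) (k : ℕ) :
    besselCoeff μ q k = (k + q) * besselCoeff μ (q + 1) k := by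
  unfold besselCoeff
  have h : (k : ℝ) + (q + 1) = (k + q) + 1 := by ring
  have hkq : (k : ℝ) + q ≠ 0 := by positivity
  rw [h, Real.Gamma_add_one hkq]
  field_simp

theorem summable_abs_besselCoeff_mul_pow (hq : 0 < q) (r : ℝ) :
    Summable fun k => |besselCoeff μ q k * r ^ k| := by
  have hstep : ∀ k : ℕ, besselCoeff μ q (k + 1) * r ^ (k + 1) =
      -μ / 4 * r / ((k + 1) * (k + q)) * (besselCoeff μ q k * r ^ k) := by
    intro k
    have h1 := besselCoeff_succ_mul (μ := μ) (q := q) k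
    rw [besselCoeff_eq_mul hq k]
    have h2 : (k : ℝ) + 1 ≠ 0 := by positivity
    have h3 : (k : ℝ) + q ≠ 0 := by positivity
    field_simp
    rw [pow_succ]
    linear_combination 4 * r ^ k * r * h1
  have hlim : Tendsto (fun k : ℕ => |(-μ / 4 * r)| / (((k : ℝ) + 1) * (k + q))) atTop (𝓝 0) := by
    refine Tendsto.div_atTop tendsto_const_nhds ?_
    exact (tendsto_atTop_add_const_right _ _ tendsto_natCast_atTop_atTop).atTop_mul_atTop₀
      (tendsto_atTop_add_const_right _ _ tendsto_natCast_atTop_atTop)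
  refine summable_of_ratio_norm_eventually_le (r := 1 / 2) (by norm_num) ?_
  filter_upwards [hlim.eventually_le_const (show (0 : ℝ) < 1 / 2 by norm_num)] with k hk
  rw [Real.norm_eq_abs, Real.norm_eq_abs, abs_abs, abs_abs, hstep, abs_mul, abs_div,
    abs_of_pos (show (0 : ℝ) < ((k : ℝ) + 1) * (k + q) by positivity)]
  gcongr

theorem summable_besselCoeff_mul_pow (hq : 0 < q) (r : ℝ) :
    Summable fun k => besselCoeff μ q k * r ^ k :=
  (summable_abs_besselCoeff_mul_pow hq r).of_abs

theorem hasDerivAt_besselSeries (hq : 0 < q) (s : ℝ) :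
    HasDerivAt (besselSeries μ q) (-μ / 4 * besselSeries μ (q + 1) s) s := by
  set r := |s| + 1 with hr
  have hr0 : 0 < r := by positivity
  have hshift : ∀ (k : ℕ) (t : ℝ), besselCoeff μ q (k + 1) * (((k + 1 : ℕ) : ℝ) * t ^ k) =
      -μ / 4 * (besselCoeff μ (q + 1) k * t ^ k) := by
    intro k t
    push_cast
    linear_combination t ^ k * besselCoeff_succ_mul (μ := μ) (q := q) k
  have hu : Summable fun k : ℕ => |besselCoeff μ q k * (k * r ^ (k - 1))| := by
    rw [← summable_nat_add_iff 1]
    simp only [Nat.add_sub_cancel, hshift, abs_mul (-μ / 4)]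
    exact (summable_abs_besselCoeff_mul_pow (by linarith) r).mul_left _
  have h := hasDerivAt_tsum_of_isPreconnected (g := fun k t => besselCoeff μ q k * t ^ k)
    (g' := fun k t => besselCoeff μ q k * (k * t ^ (k - 1))) hu Metric.isOpen_ball
    (convex_ball (0 : ℝ) r).isPreconnected
    (fun k t _ => (hasDerivAt_pow k t).const_mul _) (fun k t ht => ?_)
    (Metric.mem_ball_self hr0) (summable_besselCoeff_mul_pow hq 0)
    (show s ∈ Metric.ball (0 : ℝ) r by simp [hr])
  · refine h.congr_deriv ?_
    have hsum : Summable fun k : ℕ => besselCoeff μ q k * (k * s ^ (k - 1)) := by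
      rw [← summable_nat_add_iff 1]
      simp only [Nat.add_sub_cancel, hshift]
      exact (summable_besselCoeff_mul_pow (by linarith) s).mul_left _
    rw [hsum.tsum_eq_zero_add]
    simp only [Nat.add_sub_cancel, hshift, tsum_mul_left]
    simp [besselSeries]
  · have ht' : |t| ≤ |r| := by
      rw [abs_of_pos hr0]
      simpa using (Metric.mem_ball.1 ht).le
    rw [Real.norm_eq_abs, abs_mul, abs_mul, abs_mul, abs_mul, abs_pow, abs_pow]
    gcongr

/-- Together with the derivative formula, which raises `q` by one, this is the differential equation
`s B'' + q B' + (μ/4) B = 0`, the radial Helmholtz equation in the variable `s = r²`. -/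
theorem besselSeries_recurrence (hq : 0 < q) (s : ℝ) :
    besselSeries μ q s = q * besselSeries μ (q + 1) s - μ / 4 * s * besselSeries μ (q + 2) s := by
  have h1 := summable_besselCoeff_mul_pow (μ := μ) (q := q + 1) (by linarith) s
  have h2 : Summable fun k : ℕ => (k : ℝ) * (besselCoeff μ (q + 1) k * s ^ k) := by
    have := (summable_besselCoeff_mul_pow (μ := μ) hq s).sub (h1.mul_left q)
    refine this.congr fun k => ?_
    rw [besselCoeff_eq_mul hq k]
    ring
  have h3 : ∑' k : ℕ, (k : ℝ) * (besselCoeff μ (q + 1) k * s ^ k) =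
      -(μ / 4 * s * besselSeries μ (q + 2) s) := by
    rw [h2.tsum_eq_zero_add, besselSeries, ← tsum_mul_left, ← tsum_neg]
    simp only [Nat.cast_zero, zero_mul, zero_add]
    refine tsum_congr fun k => ?_
    have := besselCoeff_succ_mul (μ := μ) (q := q + 1) k
    rw [show q + 1 + 1 = q + 2 by ring] at this
    push_cast
    rw [pow_succ]
    linear_combination s ^ k * s * this
  rw [sub_eq_add_neg, ← h3, besselSeries, besselSeries, ← tsum_mul_left,
    ← (h1.mul_left q).tsum_add h2]
  refine tsum_congr fun k => ?_
  rw [besselCoeff_eq_mul hq k]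
  ring

theorem besselSeries_zero (hq : 0 < q) : besselSeries μ q 0 ≠ 0 := by
  rw [besselSeries, tsum_eq_single 0 fun k hk => by simp [hk]]
  simp [besselCoeff, (Real.Gamma_pos_of_pos hq).ne']

theorem contDiff_besselSeries (m : ℕ) (hq : 0 < q) : ContDiff ℝ m (besselSeries μ q) := by
  induction m generalizing q with
  | zero =>
    exact contDiff_zero.2 (continuous_iff_continuousAt.2 fun s =>
      (hasDerivAt_besselSeries hq s).continuousAt)
  | succ m ih =>
    rw [Nat.cast_add, Nat.cast_one, contDiff_succ_iff_deriv]
    refine ⟨fun s => (hasDerivAt_besselSeries hq s).differentiableAt, by simp, ?_⟩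
    rw [show deriv (besselSeries μ q) = fun s => -μ / 4 * besselSeries μ (q + 1) s from
      funext fun s => (hasDerivAt_besselSeries hq s).deriv]
    exact contDiff_const.mul (ih (by linarith))

/-- The power `r^(-ν)` cancels the non-integral part of every exponent and leaves a series in `r²`;
this makes the singular-looking example smooth. -/
theorem besselJ_eq {ν r : ℝ} (hμ : 0 < μ) (hr : 0 < r) :
    r ^ (-ν) * besselJ ν (√μ * r) = (√μ / 2) ^ ν * besselSeries μ (ν + 1) (r ^ 2) := by
  rw [besselJ, besselSeries, ← tsum_mul_left, ← tsum_mul_left]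
  refine tsum_congr fun k => ?_
  have hs : 0 < √μ := Real.sqrt_pos.2 hμ
  have hpow : (√μ * r / 2) ^ (2 * (k : ℝ) + ν) = (μ / 4) ^ k * (r ^ 2) ^ k * ((√μ / 2) ^ ν * r ^ ν) := by
    rw [Real.rpow_add (by positivity), Real.rpow_mul (by positivity), Real.rpow_natCast,
      show √μ * r / 2 = √μ / 2 * r by ring, Real.mul_rpow (z := ν) (by positivity) hr.le, ← mul_pow]
    congr 2
    rw [Real.rpow_two, mul_pow, div_pow, Real.sq_sqrt hμ.le]
    norm_num
  rw [hpow, besselCoeff, Real.rpow_neg hr.le, show (k : ℝ) + (ν + 1) = k + ν + 1 by ring,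
    show -μ / 4 = -1 * (μ / 4) by ring, mul_pow]
  have : 0 < r ^ ν := by positivity
  field_simp

end Series

/-! ### Equation, decay and nonvanishing of the radial solution. -/

section RadialSolution

open Set

/-- `r ↦ besselSeries (r²)` solves the radial Helmholtz equation in dimension `2 q`. -/
theorem isPerturbedOscillator_besselSeries {μ q : ℝ} (hq : 0 < q) :
    IsPerturbedOscillator μ ((2 * q - 1) / 2 * ((2 * q - 1) / 2 - 1)) 0
      (fun r => r ^ ((2 * q - 1) / 2) • (besselSeries μ q (r ^ 2) : ℂ))
      (fun r => ((2 * q - 1) / 2 * r ^ ((2 * q - 1) / 2 - 1)) • (besselSeries μ q (r ^ 2) : ℂ) +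
        r ^ ((2 * q - 1) / 2) •
          ((-μ / 4 * besselSeries μ (q + 1) (r ^ 2) * (2 * r) : ℝ) : ℂ)) := by
  have hsq : ∀ r : ℝ, HasDerivAt (fun r : ℝ => r ^ 2) (2 * r) r := fun r => by
    simpa using hasDerivAt_pow 2 r
  have hb : ∀ q : ℝ, 0 < q → ∀ r : ℝ, HasDerivAt (fun r : ℝ => besselSeries μ q (r ^ 2))
      (-μ / 4 * besselSeries μ (q + 1) (r ^ 2) * (2 * r)) r := fun q hq r =>
    HasDerivAt.comp (h₂ := besselSeries μ q) r (hasDerivAt_besselSeries hq (r ^ 2)) (hsq r)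
  have hb' : ∀ r : ℝ, HasDerivAt
      (fun r : ℝ => -μ / 4 * besselSeries μ (q + 1) (r ^ 2) * (2 * r))
      (-μ / 4 * (-μ / 4 * besselSeries μ (q + 1 + 1) (r ^ 2) * (2 * r)) * (2 * r) +
        -μ / 4 * besselSeries μ (q + 1) (r ^ 2) * 2) r := fun r => by
    have h2 : HasDerivAt (fun r : ℝ => 2 * r) 2 r := by
      simpa using (hasDerivAt_id r).const_mul 2
    exact ((hb (q + 1) (by linarith) r).const_mul (-μ / 4)).mul h2
  have h := isPerturbedOscillator_of_radial (μ := μ) (d := 2 * q) (c := 0) le_rfl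
    (u := fun r => (besselSeries μ q (r ^ 2) : ℂ))
    (fun r _ => (hb q hq r).ofReal_comp) (fun r _ => (hb' r).ofReal_comp) (fun r _ => ?_)
  · rw [zero_add] at h
    exact h
  · have := besselSeries_recurrence (μ := μ) hq (r ^ 2)
    rw [show q + 2 = q + 1 + 1 by ring] at this
    have hc := congrArg (fun t : ℝ => (t : ℂ)) this
    push_cast at hc ⊢
    linear_combination (μ : ℂ) * (r : ℂ) ^ 2 * hc

/-- The upper energy bound started at `R` keeps `r^((2q-1)/2) B(r²)` bounded, so no Bessel
asymptotics are needed. -/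
theorem exists_norm_besselSeries_le {μ q R : ℝ} (hμ : 0 < μ) (hq : 0 < q) (hR : 0 < R) :
    ∃ B, 0 ≤ B ∧ ∀ r, R ≤ r → |besselSeries μ q (r ^ 2)| ≤ B * r ^ (-((2 * q - 1) / 2)) := by
  have h := isPerturbedOscillator_besselSeries (μ := μ) hq
  set w := fun r : ℝ => r ^ ((2 * q - 1) / 2) • (besselSeries μ q (r ^ 2) : ℂ) with hw
  set C := (2 * q - 1) / 2 * ((2 * q - 1) / 2 - 1)
  set D := oscillatorEnergy μ w _ R * Real.exp (|C| / √μ / R) with hD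
  refine ⟨√(D / μ), by positivity, fun r hr => ?_⟩
  have hr0 : 0 < r := hR.trans_le hr
  have h1 := (h.oscillatorEnergy_bounds hμ le_rfl hR hr).2
  have h2 : ‖w r‖ ^ 2 ≤ D / μ := by
    rw [le_div_iff₀ hμ]
    refine le_trans ?_ h1
    unfold oscillatorEnergy
    rw [mul_comm]
    exact le_add_of_nonneg_left (sq_nonneg _)
  have h3 := Real.le_sqrt_of_sq_le h2
  rw [hw] at h3
  simp only [norm_smul, Complex.norm_real, Real.norm_eq_abs] at h3
  rw [abs_of_nonneg (by positivity)] at h3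
  rw [Real.rpow_neg hr0.le, ← div_eq_mul_inv, le_div_iff₀ (by positivity), mul_comm]
  exact h3

/-- If the series vanished beyond `R`, the energy would be zero at some `R₁ > R`, and the lower
energy bound would force it to be zero on all of `(0, R₁]`. By continuity the value at the origin,
`1/Γ(q)`, would be zero. -/
theorem exists_besselSeries_ne_zero {μ q : ℝ} (hμ : 0 < μ) (hq : 0 < q) (R : ℝ) :
    ∃ r, R < r ∧ besselSeries μ q (r ^ 2) ≠ 0 := by
  by_contra! hall
  have h := isPerturbedOscillator_besselSeries (μ := μ) hq
  set w := fun r : ℝ => r ^ ((2 * q - 1) / 2) • (besselSeries μ q (r ^ 2) : ℂ) with hw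
  set w' := fun r : ℝ => ((2 * q - 1) / 2 * r ^ ((2 * q - 1) / 2 - 1)) •
    (besselSeries μ q (r ^ 2) : ℂ) + r ^ ((2 * q - 1) / 2) •
      ((-μ / 4 * besselSeries μ (q + 1) (r ^ 2) * (2 * r) : ℝ) : ℂ) with hw'
  set R₁ := max R 0 + 1 with hR₁
  have hR₁0 : 0 < R₁ := by positivity
  have hR₁R : R < R₁ := by
    have := le_max_left R 0
    linarith
  have hwz : ∀ r, R < r → w r = 0 := fun r hr => by simp [hw, hall r hr]
  have hw'z : w' R₁ = 0 := by
    refine (h.hasDerivAt R₁ hR₁0).unique ((hasDerivAt_const R₁ (0 : ℂ)).congr_of_eventuallyEq ?_)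
    filter_upwards [lt_mem_nhds hR₁R] with r hr using hwz r hr
  have hE : oscillatorEnergy μ w w' R₁ = 0 := by
    simp [oscillatorEnergy, hw'z, hwz R₁ hR₁R]
  have hzero : ∀ r, 0 < r → r ≤ R₁ → besselSeries μ q (r ^ 2) = 0 := by
    intro r hr hrR
    have h1 := (h.oscillatorEnergy_bounds hμ le_rfl hr hrR).1
    rw [hE] at h1
    have h2 : oscillatorEnergy μ w w' r ≤ 0 := nonpos_of_mul_nonpos_left h1 (Real.exp_pos _)
    unfold oscillatorEnergy at h2
    have h3 : μ * ‖w r‖ ^ 2 = 0 := by nlinarith [sq_nonneg ‖w' r‖, sq_nonneg ‖w r‖]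
    have h4 : w r = 0 := by simpa [hμ.ne'] using h3
    simpa [hw, (Real.rpow_pos_of_pos hr _).ne'] using h4
  have hcont : Continuous fun r : ℝ => besselSeries μ q (r ^ 2) :=
    (contDiff_besselSeries 0 hq).continuous.comp (continuous_pow 2)
  have hlim : Filter.Tendsto (fun r : ℝ => besselSeries μ q (r ^ 2)) (𝓝[>] 0)
      (𝓝 (besselSeries μ q 0)) := by
    have := (hcont.tendsto 0).mono_left (nhdsWithin_le_nhds (s := Ioi 0))
    simpa using this
  refine besselSeries_zero (μ := μ) hq (tendsto_nhds_unique hlim ?_)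
  refine tendsto_const_nhds.congr' ?_
  filter_upwards [Ioc_mem_nhdsGT hR₁0] with r hr using (hzero r hr.1 hr.2).symm

variable {E : Type*} [NormedAddCommGroup E] [InnerProductSpace ℝ E] [FiniteDimensional ℝ E]

omit [FiniteDimensional ℝ E] in
theorem contDiff_besselSeries_norm_sq {μ q : ℝ} (hq : 0 < q) :
    ContDiff ℝ 2 fun x : E => (besselSeries μ q (‖x‖ ^ 2) : ℂ) :=
  Complex.ofRealCLM.contDiff.comp
    ((contDiff_besselSeries (μ := μ) 2 hq).comp (contDiff_norm_sq ℝ))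

/-- The entire radial solution of the Helmholtz equation. -/
theorem laplacian_besselSeries_norm_sq {μ q : ℝ} (hq : 0 < q)
    (hqd : 2 * q = Module.finrank ℝ E) (x : E) :
    Laplacian.laplacian (fun x : E => (besselSeries μ q (‖x‖ ^ 2) : ℂ)) x =
      -(μ : ℂ) * besselSeries μ q (‖x‖ ^ 2) := by
  set f := fun x : E => (besselSeries μ q (‖x‖ ^ 2) : ℂ) with hf
  set b := stdOrthonormalBasis ℝ E
  have hns : ∀ x : E, HasFDerivAt (fun x : E => ‖x‖ ^ 2) (2 • innerSL ℝ x) x := fun x =>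
    (hasStrictFDerivAt_norm_sq x).hasFDerivAt
  have hB : ∀ (q : ℝ), 0 < q → ∀ x : E, HasFDerivAt (fun x : E => besselSeries μ q (‖x‖ ^ 2))
      ((-μ / 4 * besselSeries μ (q + 1) (‖x‖ ^ 2)) • (2 • innerSL ℝ x)) x := fun q hq x =>
    (hasDerivAt_besselSeries hq _).comp_hasFDerivAt x (hns x)
  have h1 : ∀ x v : E, fderiv ℝ f x v =
      ((-μ / 2 * (besselSeries μ (q + 1) (‖x‖ ^ 2) * inner ℝ v x) : ℝ) : ℂ) := by
    intro x v
    have := Complex.ofRealCLM.hasFDerivAt.comp x (hB q hq x)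
    have h2 : fderiv ℝ f x = _ := this.fderiv
    rw [h2]
    simp [real_inner_comm]
    ring
  have hd : ContDiff ℝ 1 (fderiv ℝ f) :=
    (contDiff_besselSeries_norm_sq hq).fderiv_right (by norm_num)
  have h2 : ∀ v : E, fderiv ℝ (fderiv ℝ f) x v v =
      ((-μ / 2 * (besselSeries μ (q + 1) (‖x‖ ^ 2) * inner ℝ v v -
        μ / 2 * besselSeries μ (q + 1 + 1) (‖x‖ ^ 2) * inner ℝ v x ^ 2) : ℝ) : ℂ) := by
    intro v
    have e1 : fderiv ℝ (fderiv ℝ f) x v v = fderiv ℝ (fun y => fderiv ℝ f y v) x v := by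
      have := ((hd.differentiable one_ne_zero x).hasFDerivAt.clm_apply
        (hasFDerivAt_const v x)).fderiv
      rw [this]
      simp
    have e2 := Complex.ofRealCLM.hasFDerivAt.comp x
      (((hB (q + 1) (by linarith) x).mul (innerSL ℝ v).hasFDerivAt).const_mul (-μ / 2))
    have e3 : fderiv ℝ (fun y => fderiv ℝ f y v) x = fderiv ℝ (fun y => ((-μ / 2 *
        (besselSeries μ (q + 1) (‖y‖ ^ 2) * inner ℝ v y) : ℝ) : ℂ)) x := by
      simp only [h1]
    rw [e1, e3]
    refine (congrArg (fun l : E →L[ℝ] ℂ => l v) e2.fderiv).trans ?_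
    simp [real_inner_comm]
    ring
  rw [laplacian_eq_sum_fderiv_fderiv b]
  simp only [h2]
  rw [← Complex.ofReal_sum, ← Finset.mul_sum, Finset.sum_sub_distrib, ← Finset.mul_sum,
    ← Finset.mul_sum, b.sum_sq_inner_right]
  have h3 : ∑ i, inner ℝ (b i) (b i) = 2 * q := by
    simp [hqd]
  rw [h3, besselSeries_recurrence hq, show q + 2 = q + 1 + 1 by ring]
  push_cast
  ring

variable [MeasurableSpace E] [BorelSpace E]

theorem lintegral_besselSeries_norm_sq_lt_top {μ q R p : ℝ} (hμ : 0 < μ) (hq : 0 < q) (hR : 0 < R)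
    (hp : 0 < p) (hpd : (Module.finrank ℝ E : ℝ) < (2 * q - 1) / 2 * p) :
    ∫⁻ x in {x : E | R < ‖x‖}, ‖(besselSeries μ q (‖x‖ ^ 2) : ℂ)‖ₑ ^ p < ∞ := by
  obtain ⟨B, hB0, hB⟩ := exists_norm_besselSeries_le hμ hq hR
  set a := (2 * q - 1) / 2 with ha
  have ha0 : 0 < a := by
    have : 0 < a * p := lt_of_le_of_lt (Nat.cast_nonneg _) hpd
    exact pos_of_mul_pos_left this hp.le
  -- With this ratio `θ (1 + ‖x‖) ≤ ‖x‖` outside the ball of radius `R`, so powers of `‖x‖` may be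
  -- replaced by powers of `1 + ‖x‖`, whose integrability is known.
  set θ := R / (1 + R) with hθ
  have hθ0 : 0 < θ := by positivity
  set T := (B * θ ^ (-a)) ^ p with hT
  have hT0 : 0 ≤ T := by positivity
  refine lt_of_le_of_lt ?_ (ENNReal.mul_lt_top (ENNReal.ofReal_lt_top (r := T))
    (finite_integral_one_add_norm (μ := (volume : Measure E)) hpd))
  rw [← lintegral_const_mul' _ _ ENNReal.ofReal_ne_top]
  refine le_trans (setLIntegral_mono' (measurableSet_lt measurable_const measurable_norm)
    fun x hx => ?_) (setLIntegral_le_lintegral _ _)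
  have hx' : R < ‖x‖ := hx
  have hx0 : 0 < ‖x‖ := hR.trans hx'
  rw [← ofReal_norm, ENNReal.ofReal_rpow_of_nonneg (norm_nonneg _) hp.le,
    ← ENNReal.ofReal_mul hT0, Complex.norm_real, Real.norm_eq_abs]
  refine ENNReal.ofReal_le_ofReal ?_
  have h1 : θ * (1 + ‖x‖) ≤ ‖x‖ := by
    rw [hθ, div_mul_eq_mul_div, div_le_iff₀ (by positivity)]
    nlinarith
  have h2 : ‖x‖ ^ (-a) ≤ θ ^ (-a) * (1 + ‖x‖) ^ (-a) := by
    rw [← Real.mul_rpow hθ0.le (by positivity)]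
    exact Real.rpow_le_rpow_of_nonpos (by positivity) h1 (by linarith)
  calc |besselSeries μ q (‖x‖ ^ 2)| ^ p ≤ (B * (θ ^ (-a) * (1 + ‖x‖) ^ (-a))) ^ p := by
        refine Real.rpow_le_rpow (abs_nonneg _) ((hB _ hx'.le).trans ?_) hp.le
        gcongr
    _ = T * (1 + ‖x‖) ^ (-(a * p)) := by
        rw [← mul_assoc, Real.mul_rpow (by positivity) (by positivity), hT,
          ← Real.rpow_mul (by positivity), neg_mul]

end RadialSolution

/-! ### The two halves of the theorem in Euclidean space. -/

theorem helmholtzBessel_eq {n : ℕ} {μ : ℝ} (hμ : 0 < μ) {x : EuclideanSpace ℝ (Fin n)}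
    (hx : x ≠ 0) : helmholtzBessel n μ x =
      ((√μ / 2) ^ (((n : ℝ) - 2) / 2) : ℝ) * (besselSeries μ (n / 2) (‖x‖ ^ 2) : ℂ) := by
  rw [helmholtzBessel, besselJ_eq hμ (norm_pos_iff.2 hx),
    show ((n : ℝ) - 2) / 2 + 1 = n / 2 by ring, Complex.ofReal_mul]

theorem eq_zero_of_isHelmholtzSolutionOn_exteriorDomain {n : ℕ} (hn : 2 ≤ n) {μ R R' p : ℝ}
    (hμ : 0 < μ) (hR : 0 ≤ R) (hRR' : R ≤ R') {f : EuclideanSpace ℝ (Fin n) → ℂ}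
    (hf : IsHelmholtzSolutionOn μ f (exteriorDomain n R)) (hp : 0 < p)
    (hpn : p ≤ 2 * (n : ℝ) / ((n : ℝ) - 1)) (hfin : pIntegral p f (exteriorDomain n R') < ∞)
    {x : EuclideanSpace ℝ (Fin n)} (hx : x ∈ exteriorDomain n R) : f x = 0 := by
  have hd : Module.finrank ℝ (EuclideanSpace ℝ (Fin n)) = n := finrank_euclideanSpace_fin
  have hnt : Nontrivial (EuclideanSpace ℝ (Fin n)) :=
    Module.nontrivial_of_finrank_pos (R := ℝ) (by omega)
  have hn' : (2 : ℝ) ≤ n := by exact_mod_cast hn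
  rcases le_or_gt 1 p with hp1 | hp1
  · refine eq_zero_of_setLIntegral_rpow_lt_top hμ hR hf.1 hf.2 hp1 ?_ hfin hx
    rw [le_div_iff₀ (by linarith)] at hpn
    rw [hd]
    linarith
  -- For `p < 1`, integrability is first improved to exponent `1` on a smaller exterior domain.
  -- Exponent `1` is always admissible, as `n - 1 ≤ 2n`, and vanishing still follows on the whole
  -- original domain.
  · have hsub : {x : EuclideanSpace ℝ (Fin n) | R' < ‖x‖} ⊆ exteriorDomain n R :=
      fun y hy => lt_of_le_of_lt hRR' hy
    obtain ⟨S, hS⟩ := exists_setLIntegral_enorm_lt_top (by omega) hμ (hf.1.mono hsub)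
      (fun y hy => hf.2 y (hsub hy)) hp hp1.le hfin
    refine eq_zero_of_setLIntegral_rpow_lt_top (p := 1) (R' := S) hμ hR hf.1 hf.2 le_rfl ?_ ?_ hx
    · linarith [hd]
    · simpa using hS

theorem isHelmholtzSolutionOn_helmholtzBessel {n : ℕ} (hn : 0 < n) {μ R : ℝ} (hμ : 0 < μ)
    (hR : 0 ≤ R) : IsHelmholtzSolutionOn μ (helmholtzBessel n μ) (exteriorDomain n R) := by
  have hq : (0 : ℝ) < n / 2 := by positivity
  have hopen : IsOpen (exteriorDomain n R) := isOpen_lt continuous_const continuous_norm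
  set c : ℂ := (((√μ / 2) ^ (((n : ℝ) - 2) / 2) : ℝ) : ℂ) with hc
  set F := fun x : EuclideanSpace ℝ (Fin n) => (besselSeries μ (n / 2) (‖x‖ ^ 2) : ℂ) with hF
  have hFc : ContDiff ℝ 2 F := contDiff_besselSeries_norm_sq hq
  have heq : ∀ x ∈ exteriorDomain n R, helmholtzBessel n μ x = c * F x := fun x hx =>
    helmholtzBessel_eq hμ (norm_pos_iff.1 (lt_of_le_of_lt hR hx))
  refine ⟨(contDiff_const.mul hFc).contDiffOn.congr heq, fun x hx => ?_⟩
  have hev : helmholtzBessel n μ =ᶠ[𝓝 x] fun y => c * F y :=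
    Filter.eventuallyEq_of_mem (hopen.mem_nhds hx) heq
  have h1 : Laplacian.laplacian (helmholtzBessel n μ) x =
      Laplacian.laplacian (fun y => c * F y) x := (InnerProductSpace.laplacian_congr_nhds hev).eq_of_nhds
  have h2 : Laplacian.laplacian (fun y => c * F y) x = c * Laplacian.laplacian F x := by
    have := InnerProductSpace.laplacian_smul ((√μ / 2) ^ (((n : ℝ) - 2) / 2)) (hFc.contDiffAt (x := x))
    simpa [hc, Pi.smul_def] using this
  rw [h1, h2, heq x hx, laplacian_besselSeries_norm_sq hq (by
    rw [finrank_euclideanSpace_fin]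
    ring)]
  ring

theorem exists_helmholtzBessel_ne_zero {n : ℕ} (hn : 0 < n) {μ R : ℝ} (hμ : 0 < μ) (hR : 0 ≤ R) :
    ∃ x ∈ exteriorDomain n R, helmholtzBessel n μ x ≠ 0 := by
  obtain ⟨r, hr, hne⟩ := exists_besselSeries_ne_zero (q := (n : ℝ) / 2) hμ (by positivity) R
  have hr0 : 0 < r := hR.trans_lt hr
  have hnt : Nontrivial (EuclideanSpace ℝ (Fin n)) :=
    Module.nontrivial_of_finrank_pos (R := ℝ) (by simpa using hn)
  obtain ⟨x, hx⟩ := exists_norm_eq (EuclideanSpace ℝ (Fin n)) hr0.le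
  have hs : 0 < √μ := Real.sqrt_pos.2 hμ
  refine ⟨x, by simpa [exteriorDomain, hx] using hr, ?_⟩
  rw [helmholtzBessel_eq hμ (norm_pos_iff.1 (hx ▸ hr0)), hx]
  refine mul_ne_zero ?_ (by exact_mod_cast hne)
  exact_mod_cast (Real.rpow_pos_of_pos (by positivity) _).ne'

theorem pIntegral_helmholtzBessel_lt_top {n : ℕ} (hn : 2 ≤ n) {μ R p : ℝ} (hμ : 0 < μ)
    (hR : 0 < R) (hp : 2 * (n : ℝ) / ((n : ℝ) - 1) < p) :
    pIntegral p (helmholtzBessel n μ) (exteriorDomain n R) < ∞ := by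
  have hn' : (2 : ℝ) ≤ n := by exact_mod_cast hn
  have hp0 : 0 < p := lt_of_le_of_lt (div_nonneg (by positivity) (by linarith)) hp
  rw [div_lt_iff₀ (by linarith)] at hp
  set c : ℂ := (((√μ / 2) ^ (((n : ℝ) - 2) / 2) : ℝ) : ℂ) with hc
  have hcp : ‖c‖ₑ ^ p ≠ ∞ := ENNReal.rpow_ne_top_of_nonneg hp0.le enorm_ne_top
  have hmeas : MeasurableSet (exteriorDomain n R) :=
    measurableSet_lt measurable_const measurable_norm
  have heq : pIntegral p (helmholtzBessel n μ) (exteriorDomain n R) =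
      ‖c‖ₑ ^ p * ∫⁻ x in exteriorDomain n R, ‖(besselSeries μ (n / 2) (‖x‖ ^ 2) : ℂ)‖ₑ ^ p := by
    rw [pIntegral, ← lintegral_const_mul' _ _ hcp]
    refine setLIntegral_congr_fun hmeas fun x hx => ?_
    rw [helmholtzBessel_eq hμ (norm_pos_iff.1 (hR.trans hx)), enorm_mul,
      ENNReal.mul_rpow_of_nonneg _ _ hp0.le]
  rw [heq]
  refine ENNReal.mul_lt_top hcp.lt_top
    (lintegral_besselSeries_norm_sq_lt_top hμ (by positivity) hR hp0 ?_)
  rw [finrank_euclideanSpace_fin]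
  linarith

theorem theorem1p1 (n : ℕ) (hn : 2 ≤ n) (μ : ℝ) (hμ : 0 < μ) (R₀ : ℝ) (hR₀ : 0 < R₀) :
    (∀ (f : EuclideanSpace ℝ (Fin n) → ℂ) (p : ℝ),
      IsHelmholtzSolutionOn μ f (exteriorDomain n R₀) →
      0 < p → p ≤ 2 * (n : ℝ) / ((n : ℝ) - 1) →
      pIntegral p f (exteriorDomain n (R₀ + 4)) < ∞ →
      ∀ x ∈ exteriorDomain n R₀, f x = 0) ∧
    (∀ p : ℝ, 2 * (n : ℝ) / ((n : ℝ) - 1) < p →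
      IsHelmholtzSolutionOn μ (helmholtzBessel n μ) (exteriorDomain n R₀) ∧
      (∃ x ∈ exteriorDomain n R₀, helmholtzBessel n μ x ≠ 0) ∧
      pIntegral p (helmholtzBessel n μ) (exteriorDomain n R₀) < ∞) := by
  refine ⟨fun f p hf hp hpn hfin x hx => ?_, fun p hp => ⟨?_, ?_, ?_⟩⟩
  · exact eq_zero_of_isHelmholtzSolutionOn_exteriorDomain hn hμ hR₀.le (by linarith) hf hp hpn
      hfin hx
  · exact isHelmholtzSolutionOn_helmholtzBessel (by omega) hμ hR₀.le
  · exact exists_helmholtzBessel_ne_zero (by omega) hμ hR₀.le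
  · exact pIntegral_helmholtzBessel_lt_top hn hμ hR₀ hp
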